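/- **Setting.** Let $G,\tilde G$ be real Lie groups with simple Lie algebras $\mathfrak g,\tilde{\mathfrak g}$, and let $P\subseteq G$, $\tilde P\subseteq\tilde G$ be parabolic subgroups, i.e. closed subgroups whose Lie algebras $\mathfrak p,\tilde{\mathfrak p}$ satisfy $\mathfrak p_+=\mathfrak p^{\perp}$, $\tilde{\mathfrak p}_+=\tilde{\mathfrak p}^{\perp}$, where the subscript $+$ denotes the nilradical (largest nilpotent ideal) and $\perp$ the orthogonal complement for the Killing form. Assume that $\tilde{\mathfrak p}$ is the parabolic of a $|1|$-grading: $\tilde{\mathfrak g}=\tilde{\mathfrak g}_{-1}\oplus\tilde{\mathfrak g}_0\oplus\tilde{\mathfrak g}_1$ is a Lie algebra grading with $\tilde{\mathfrak g}_1\neq0$ and $\tilde{\mathfrak p}=\tilde{\mathfrak g}_0\oplus\tilde{\mathfrak g}_1$. Let $i:G\to\tilde G$ be a homomorphism of Lie groups with injective derivative $i':\mathfrak g\to\tilde{\mathfrak g}$ such that the $G$-orbit of the origin in $\tilde G/\tilde P$ is open and $Q:=i^{-1}(\tilde P)\subseteq P$. A Cartan geometry of type $(G,P)$ is a smooth principal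 $P$-bundle $\mathcal G\to M$ with a Cartan connection $\omega\in\Omega^1(\mathcal G,\mathfrak g)$, that is, a smooth $P$-equivariant one-form which reproduces the generators of fundamental vector fields and is a linear isomorphism $\omega(u):T_u\mathcal G\to\mathfrak g$ for each $u$. Its curvature is $K(\xi,\eta)=d\omega(\xi,\eta)+[\omega(\xi),\omega(\eta)]$, and its curvature function $\kappa:\mathcal G\to\Lambda^2(\mathfrak g/\mathfrak p)^*\otimes\mathfrak g$ is $\kappa(u)(X+\mathfrak p,Y+\mathfrak p)=K(\omega(u)^{-1}X,\omega(u)^{-1}Y)$. Let $X_1,\dots,X_n\in\mathfrak g$ project to a basis of $\mathfrak g/\mathfrak p$ and let $Z_1,\dots,Z_n\in\mathfrak p_+\cong(\mathfrak g/\mathfrak p)^*$ be the dual basis (with respect to the Killing form). For $\phi\in\Lambda^2(\mathfrak g/\mathfrak p)^*\otimes\mathfrak g$ the Kostant codifferential is $\partial^*\phi=\partial^*_1\phi+\partial^*_2\phi$ with $$\partial_1^*\phi(X)=2\sum_{j=1}^n[\phi(X_j,X),Z_j],\qquad \partial_2^*\phi(X)=\sum_{j=1}^n\phi(X_j,[Z_j,X]).$$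 The geometry is called normal if $\partial^*\circ\kappa=0$. The same definitions apply to type $(\tilde G,\tilde P)$. Given a Cartan geometry $(\mathcal G\to M,\omega)$ of type $(G,P)$, the Fefferman-type construction forms $\tilde M:=\mathcal G/Q$ and $\tilde{\mathcal G}:=\mathcal G\times_Q\tilde P\to\tilde M$ with their quotient manifold structures, the natural map $j:\mathcal G\to\tilde{\mathcal G}$, $j(u)=[u,1]$, and the unique Cartan connection $\tilde\omega$ of type $(\tilde G,\tilde P)$ on $\tilde{\mathcal G}$ with $j^*\tilde\omega=i'\circ\omega$. **Proposition.** Suppose that the curvature function $\kappa$ of $(\mathcal G,\omega)$ takes values in $\Lambda^2(\mathfrak g/\mathfrak p)^*\otimes(\mathfrak g\cap\tilde{\mathfrak p})$, where $\mathfrak g\cap\tilde{\mathfrak p}:=\{A\in\mathfrak g: i'(A)\in\tilde{\mathfrak p}\}$, and that $\partial_1^*\circ\kappa=0$ and $\partial_2^*\circ\kappa=0$. Then the induced geometry $(\tilde{\mathcal G},\tilde\omega)$ is normal. -/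

import Mathlib

open scoped Manifold ContDiff Topology

noncomputable section

namespace Parabolic

instance instLEInftyMinSmoothnessReal : ENat.LEInfty (minSmoothness ℝ 3) :=
  ⟨by rw [minSmoothness_of_isRCLikeNormedField]; exact ENat.LEInfty.out⟩

/-! ### Lie algebras -/

section LieAlgebra

variable {L : Type*} [LieRing L] [LieAlgebra ℝ L]

variable (L) in
/-- The nilradical: the largest ideal of `L` that is nilpotent as a Lie algebra. (This is not
Mathlib's `LieAlgebra.maxNilpotentIdeal`, which asks that all of `L` act nilpotently on the
ideal.) -/
def nilradical : LieIdeal ℝ L :=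
  sSup {J : LieIdeal ℝ L | LieRing.IsNilpotent J}

/-- The orthogonal complement of a subspace with respect to the Killing form. -/
def killingPerp (V : Submodule ℝ L) : Submodule ℝ L where
  carrier := {x | ∀ y ∈ V, killingForm ℝ L x y = 0}
  add_mem' := fun {a b} ha hb y hy => by
    rw [map_add, LinearMap.add_apply, ha y hy, hb y hy, add_zero]
  zero_mem' := fun y _ => by rw [map_zero, LinearMap.zero_apply]
  smul_mem' := fun c x hx y hy => by
    rw [map_smul, LinearMap.smul_apply, hx y hy, smul_zero]

/-- `𝔭` is the non-negative part `𝔤₀ ⊕ 𝔤₁` of a grading `L = 𝔤₋₁ ⊕ 𝔤₀ ⊕ 𝔤₁` of the Lie algebra `L`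
(a `|1|`-grading, of depth exactly one). -/
def IsOneGraded (𝔭 : Submodule ℝ L) : Prop :=
  ∃ 𝔤 : ℤ → Submodule ℝ L, DirectSum.IsInternal 𝔤 ∧
    (∀ i j : ℤ, ∀ x ∈ 𝔤 i, ∀ y ∈ 𝔤 j, ⁅x, y⁆ ∈ 𝔤 (i + j)) ∧
    (∀ i : ℤ, 1 < |i| → 𝔤 i = ⊥) ∧ 𝔤 1 ≠ ⊥ ∧ 𝔭 = 𝔤 0 ⊔ 𝔤 1

/-- `X₁, …, Xₙ ∈ L` project to a basis of `L / 𝔭`, and `Z₁, …, Zₙ ∈ 𝔭₊` is the dual basis under the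
identification `𝔭₊ ≅ (L / 𝔭)^*` given by the Killing form. -/
structure IsDualFrame (𝔭 𝔭plus : Submodule ℝ L) {n : ℕ} (X Z : Fin n → L) : Prop where
  linearIndependent : LinearIndependent ℝ (fun i => 𝔭.mkQ (X i))
  span_eq_top : Submodule.span ℝ (Set.range fun i => 𝔭.mkQ (X i)) = ⊤
  mem_nilradical : ∀ i, Z i ∈ 𝔭plus
  dual : ∀ i j, killingForm ℝ L (Z i) (X j) = if i = j then 1 else 0

/-- The first summand `∂₁^* φ (A) = 2 ∑ᵢ [φ(Xᵢ, A), Zᵢ]` of the Kostant codifferential on two-cochains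
with values in `L`. A two-cochain on `L / 𝔭` is written as a function on `L × L`. -/
def codiffOne {n : ℕ} (X Z : Fin n → L) (φ : L → L → L) (A : L) : L :=
  (2 : ℝ) • ∑ i, ⁅φ (X i) A, Z i⁆

/-- The second summand `∂₂^* φ (A) = ∑ᵢ φ(Xᵢ, [Zᵢ, A])` of the Kostant codifferential. -/
def codiffTwo {n : ℕ} (X Z : Fin n → L) (φ : L → L → L) (A : L) : L :=
  ∑ i, φ (X i) ⁅Z i, A⁆

/-- The Kostant codifferential `∂^* = ∂₁^* + ∂₂^*`. -/
def codiff {n : ℕ} (X Z : Fin n → L) (φ : L → L → L) (A : L) : L :=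
  codiffOne X Z φ A + codiffTwo X Z φ A

end LieAlgebra

/-! ### Lie groups and parabolic subgroups -/

section LieGroup

variable {E H : Type*} [NormedAddCommGroup E] [NormedSpace ℝ E] [TopologicalSpace H]
  (I : ModelWithCorners ℝ E H) {G : Type*} [TopologicalSpace G] [ChartedSpace H G] [Group G]
  {E' H' : Type*} [NormedAddCommGroup E'] [NormedSpace ℝ E'] [TopologicalSpace H']
  (I' : ModelWithCorners ℝ E' H') {G' : Type*} [TopologicalSpace G'] [ChartedSpace H' G'] [Group G']

/-- The adjoint action of `g : G` on the Lie algebra of `G`: the derivative at the identity of the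
conjugation by `g`. -/
def Ad (g : G) : GroupLieAlgebra I G →L[ℝ] GroupLieAlgebra I G :=
  mfderiv I I (fun x : G => g * x * g⁻¹) 1

/-- The derivative at the identity of a homomorphism of Lie groups. -/
def lieMap (f : G →* G') : GroupLieAlgebra I G →L[ℝ] GroupLieAlgebra I' G' :=
  mfderiv I I' f 1

variable (P : Subgroup G) [ChartedSpace H' P]

/-- The Lie algebra of a Lie subgroup, as a subspace of the Lie algebra of the group. -/
def subgroupLieAlgebra : Submodule ℝ (GroupLieAlgebra I G) :=
  LinearMap.range (lieMap I' I P.subtype).toLinearMap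

variable [CompleteSpace E] [LieGroup I ∞ G] [CompleteSpace E'] [LieGroup I' ∞ P]

/-- The nilradical of the Lie algebra of a Lie subgroup `P`, as a subspace of the Lie algebra of
the group. -/
def subgroupNilradical : Submodule ℝ (GroupLieAlgebra I G) :=
  (nilradical (GroupLieAlgebra I' P)).toSubmodule.map (lieMap I' I P.subtype).toLinearMap

/-- `P` is a parabolic subgroup of `G`: it is a closed, embedded Lie subgroup, and the nilradical
of its Lie algebra is the orthogonal complement of the Lie algebra for the Killing form. The
topology of `P` is the subspace topology. -/
structure IsParabolicSubgroup : Prop where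
  isClosed : IsClosed (P : Set G)
  contMDiff_subtype : ContMDiff I' I ∞ (Subtype.val : P → G)
  injective_mfderiv : ∀ p : P, Function.Injective (mfderiv I' I (Subtype.val : P → G) p)
  nilradical_eq : subgroupNilradical I I' P = killingPerp (subgroupLieAlgebra I I' P)

end LieGroup

/-! ### Differential forms of degree one -/

section Forms

variable {E H : Type*} [NormedAddCommGroup E] [NormedSpace ℝ E] [TopologicalSpace H]
  (I : ModelWithCorners ℝ E H) {M : Type*} [TopologicalSpace M] [ChartedSpace H M]
  {F : Type*} [NormedAddCommGroup F] [NormedSpace ℝ F]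

/-- An `F`-valued one-form is smooth if it is smooth as a function on the tangent bundle. -/
def IsSmoothForm [IsManifold I ∞ M] (θ : ∀ u : M, TangentSpace I u →L[ℝ] F) : Prop :=
  ContMDiff I.tangent 𝓘(ℝ, F) ∞ (fun v : TangentBundle I M => θ v.proj v.snd)

/-- The expression of an `F`-valued one-form in the preferred chart at `u`, i.e. its pullback along
the inverse of the chart. -/
def formInChart (θ : ∀ u : M, TangentSpace I u →L[ℝ] F) (u : M) (x : E) : E [⋀^Fin 1]→L[ℝ] F :=
  ContinuousAlternatingMap.ofSubsingleton ℝ E F (0 : Fin 1)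
    ((θ ((extChartAt I u).symm x)).comp
      (mfderivWithin 𝓘(ℝ, E) I (extChartAt I u).symm (Set.range I) x))

/-- The exterior derivative of an `F`-valued one-form, computed in the preferred chart at the point,
with the convention `dθ(ξ,η) = ξ·θ(η) - η·θ(ξ) - θ([ξ,η])`. -/
def mextDeriv (θ : ∀ u : M, TangentSpace I u →L[ℝ] F) (u : M) (v w : TangentSpace I u) : F :=
  extDerivWithin (formInChart I θ u) (Set.range I) (extChartAt I u u)
    ![mfderiv I 𝓘(ℝ, E) (extChartAt I u) u v, mfderiv I 𝓘(ℝ, E) (extChartAt I u) u w]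

end Forms

/-- A smooth submersion between manifolds (of finite dimension). -/
structure IsSmoothSubmersion {E H : Type*} [NormedAddCommGroup E] [NormedSpace ℝ E]
    [TopologicalSpace H] (I : ModelWithCorners ℝ E H) {M : Type*} [TopologicalSpace M]
    [ChartedSpace H M] {E' H' : Type*} [NormedAddCommGroup E'] [NormedSpace ℝ E']
    [TopologicalSpace H'] (I' : ModelWithCorners ℝ E' H') {M' : Type*} [TopologicalSpace M']
    [ChartedSpace H' M'] (f : M → M') : Prop where
  contMDiff : ContMDiff I I' ∞ f
  surjective_mfderiv : ∀ x, Function.Surjective (mfderiv I I' f x)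

/-! ### Cartan geometries -/

section Cartan

variable {E H : Type*} [NormedAddCommGroup E] [NormedSpace ℝ E] [TopologicalSpace H]
  (I : ModelWithCorners ℝ E H) {G : Type*} [TopologicalSpace G] [ChartedSpace H G] [Group G]
  {EP HP : Type*} [NormedAddCommGroup EP] [NormedSpace ℝ EP] [TopologicalSpace HP]
  (IP : ModelWithCorners ℝ EP HP) {P : Subgroup G} [ChartedSpace HP P]
  {EB HB : Type*} [NormedAddCommGroup EB] [NormedSpace ℝ EB] [TopologicalSpace HB]
  (IB : ModelWithCorners ℝ EB HB) {B : Type*} [TopologicalSpace B] [ChartedSpace HB B]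
  [MulAction (P)ᵐᵒᵖ B]
  {EM HM : Type*} [NormedAddCommGroup EM] [NormedSpace ℝ EM] [TopologicalSpace HM]
  (IM : ModelWithCorners ℝ EM HM) {M : Type*} [TopologicalSpace M] [ChartedSpace HM M]

/-- `π : B → M` is a smooth principal bundle with structure group `P`, for the right action of `P`
on `B` (written as a left action of the opposite group): around every point of `M` there is a
smooth `P`-equivariant local trivialization. -/
structure IsPrincipalBundle (π : B → M) : Prop where
  contMDiff_action : ContMDiff (IB.prod IP) IB ∞ (fun x : B × P => MulOpposite.op x.2 • x.1)
  proj_action : ∀ (u : B) (p : P), π (MulOpposite.op p • u) = π u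
  locally_trivial : ∀ x : M, ∃ e : Bundle.Trivialization P π, x ∈ e.baseSet ∧
    ContMDiffOn IB (IM.prod IP) ∞ e e.source ∧
    ContMDiffOn (IM.prod IP) IB ∞ e.toOpenPartialHomeomorph.symm e.target ∧
    ∀ u ∈ e.source, ∀ p : P, (e (MulOpposite.op p • u)).2 = (e u).2 * p

/-- `θ` is a Cartan connection of type `(G, P)` on `B`: a smooth one-form with values in the Lie
algebra of `G` that is equivariant, reproduces the generators of the fundamental vector fields, and
is a linear isomorphism at each point. -/
structure IsCartanConnection [IsManifold IB ∞ B]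
    (θ : ∀ u : B, TangentSpace IB u →L[ℝ] GroupLieAlgebra I G) : Prop where
  smooth : IsSmoothForm (F := E) IB θ
  equivariant : ∀ (u : B) (p : P) (ξ : TangentSpace IB u),
    θ (MulOpposite.op p • u) (mfderiv IB IB (fun v : B => MulOpposite.op p • v) u ξ) =
      Ad I (p : G)⁻¹ (θ u ξ)
  fundamental : ∀ (u : B) (A : GroupLieAlgebra IP P),
    θ (MulOpposite.op (1 : P) • u) (mfderiv IP IB (fun p : P => MulOpposite.op p • u) 1 A) =
      lieMap IP I P.subtype A
  isInvertible : ∀ u : B, (θ u).IsInvertible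

/-- The exterior derivative `dθ` of a one-form with values in the Lie algebra of `G`. The Lie algebra
of `G` is, as a normed space, the model space `E`. -/
def lieExtDeriv (θ : ∀ u : B, TangentSpace IB u →L[ℝ] GroupLieAlgebra I G) (u : B)
    (ξ η : TangentSpace IB u) : GroupLieAlgebra I G :=
  mextDeriv (F := E) IB θ u ξ η

/-- The curvature `K(ξ, η) = dθ(ξ, η) + [θ(ξ), θ(η)]` of a Cartan connection. -/
def curvature (θ : ∀ u : B, TangentSpace IB u →L[ℝ] GroupLieAlgebra I G) (u : B)
    (ξ η : TangentSpace IB u) : GroupLieAlgebra I G :=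
  lieExtDeriv I IB θ u ξ η + ⁅θ u ξ, θ u η⁆

/-- The curvature function `κ(u)(X + 𝔭, Y + 𝔭) = K(θ⁻¹(u)(X), θ⁻¹(u)(Y))`, written on
representatives `X`, `Y` in the Lie algebra of `G`. -/
def curvatureFunction (θ : ∀ u : B, TangentSpace IB u →L[ℝ] GroupLieAlgebra I G) (u : B)
    (X Y : GroupLieAlgebra I G) : GroupLieAlgebra I G :=
  curvature I IB θ u ((θ u).inverse X) ((θ u).inverse Y)

variable [CompleteSpace E] [LieGroup I ∞ G] [CompleteSpace EP] [LieGroup IP ∞ P]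

variable (P) in
/-- `∂₁^* ∘ κ = 0`. The codifferential does not depend on the choice of the dual frame. -/
def CodiffOneVanishes (θ : ∀ u : B, TangentSpace IB u →L[ℝ] GroupLieAlgebra I G) : Prop :=
  ∀ (n : ℕ) (X Z : Fin n → GroupLieAlgebra I G),
    IsDualFrame (subgroupLieAlgebra I IP P) (subgroupNilradical I IP P) X Z →
    ∀ (u : B) (A : GroupLieAlgebra I G), codiffOne X Z (curvatureFunction I IB θ u) A = 0

variable (P) in
/-- `∂₂^* ∘ κ = 0`. -/
def CodiffTwoVanishes (θ : ∀ u : B, TangentSpace IB u →L[ℝ] GroupLieAlgebra I G) : Prop :=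
  ∀ (n : ℕ) (X Z : Fin n → GroupLieAlgebra I G),
    IsDualFrame (subgroupLieAlgebra I IP P) (subgroupNilradical I IP P) X Z →
    ∀ (u : B) (A : GroupLieAlgebra I G), codiffTwo X Z (curvatureFunction I IB θ u) A = 0

variable (P) in
/-- A parabolic geometry of type `(G, P)` is normal if `∂^* ∘ κ = 0`. -/
def IsNormal (θ : ∀ u : B, TangentSpace IB u →L[ℝ] GroupLieAlgebra I G) : Prop :=
  ∀ (n : ℕ) (X Z : Fin n → GroupLieAlgebra I G),
    IsDualFrame (subgroupLieAlgebra I IP P) (subgroupNilradical I IP P) X Z →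
    ∀ (u : B) (A : GroupLieAlgebra I G), codiff X Z (curvatureFunction I IB θ u) A = 0

end Cartan

/-! ### The Fefferman-type construction -/

section Fefferman

variable {G G' : Type*} [Group G] [Group G'] {P : Subgroup G} {P' : Subgroup G'} {i : G →* G'}
  (hQ : P'.comap i ≤ P) (B : Type*) [MulAction (P)ᵐᵒᵖ B]

/-- The orbit relation of `Q = i⁻¹(P')` on `B`. -/
def spaceSetoid : Setoid B where
  r u v := ∃ (q : G) (hq : q ∈ P'.comap i),
    v = MulOpposite.op (⟨q, hQ hq⟩ : P) • u
  iseqv :=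
    { refl := fun u => ⟨1, one_mem _, (one_smul (P)ᵐᵒᵖ u).symm⟩
      symm := by
        rintro u v ⟨q, hq, rfl⟩
        refine ⟨q⁻¹, inv_mem hq, ?_⟩
        rw [smul_smul, ← MulOpposite.op_mul, MulMemClass.mk_mul_mk]
        simp only [mul_inv_cancel]
        exact (one_smul (P)ᵐᵒᵖ u).symm
      trans := by
        rintro u v w ⟨q, hq, rfl⟩ ⟨r, hr, rfl⟩
        refine ⟨q * r, mul_mem hq hr, ?_⟩
        rw [smul_smul, ← MulOpposite.op_mul, MulMemClass.mk_mul_mk] }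

/-- The Fefferman space `B / Q`. -/
def FeffermanSpace : Type _ := Quotient (spaceSetoid hQ B)

/-- The orbit relation of `Q = i⁻¹(P')` on `B × P'`, for the action `(u, a) · q = (u q, i(q)⁻¹ a)`. -/
def bundleSetoid : Setoid (B × P') where
  r x y := ∃ (q : G) (hq : q ∈ P'.comap i),
    y.1 = MulOpposite.op (⟨q, hQ hq⟩ : P) • x.1 ∧ y.2 = (⟨i q, hq⟩ : P')⁻¹ * x.2
  iseqv :=
    { refl := fun x => ⟨1, one_mem _, (one_smul (P)ᵐᵒᵖ x.1).symm, by
        apply Subtype.ext; simp⟩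
      symm := by
        rintro ⟨u, a⟩ ⟨v, b⟩ ⟨q, hq, h1, h2⟩
        dsimp only at h1 h2
        subst h1 h2
        refine ⟨q⁻¹, inv_mem hq, ?_, ?_⟩
        · dsimp only
          rw [smul_smul, ← MulOpposite.op_mul, MulMemClass.mk_mul_mk]
          simp only [mul_inv_cancel]
          exact (one_smul (P)ᵐᵒᵖ u).symm
        · apply Subtype.ext; simp
      trans := by
        rintro ⟨u, a⟩ ⟨v, b⟩ ⟨w, c⟩ ⟨q, hq, h1, h2⟩ ⟨r, hr, h3, h4⟩
        dsimp only at h1 h2 h3 h4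
        subst h1 h2 h3 h4
        refine ⟨q * r, mul_mem hq hr, ?_, ?_⟩
        · dsimp only
          rw [smul_smul, ← MulOpposite.op_mul, MulMemClass.mk_mul_mk]
        · apply Subtype.ext; simp [mul_assoc] }

/-- The extended bundle `B ×_Q P'`. -/
def ExtendedBundle : Type _ := Quotient (bundleSetoid hQ B)

namespace FeffermanSpace

instance [TopologicalSpace B] : TopologicalSpace (FeffermanSpace hQ B) :=
  inferInstanceAs (TopologicalSpace (Quotient (spaceSetoid hQ B)))

variable {B} in
/-- The projection `B → B / Q`. -/
def mk (u : B) : FeffermanSpace hQ B := Quotient.mk (spaceSetoid hQ B) u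

end FeffermanSpace

namespace ExtendedBundle

instance [TopologicalSpace B] [TopologicalSpace G'] : TopologicalSpace (ExtendedBundle hQ B) :=
  inferInstanceAs (TopologicalSpace (Quotient (bundleSetoid hQ B)))

variable {B} in
/-- The projection `B × P' → B ×_Q P'`. -/
def mk (x : B × P') : ExtendedBundle hQ B := Quotient.mk (bundleSetoid hQ B) x

variable {B} in
/-- The natural inclusion `j : B → B ×_Q P'`, `u ↦ [u, 1]`. -/
def incl (u : B) : ExtendedBundle hQ B := mk hQ (u, 1)

/-- The principal right action `[u, a] · b = [u, a b]` of `P'` on `B ×_Q P'`. -/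
instance : MulAction (P')ᵐᵒᵖ (ExtendedBundle hQ B) where
  smul b := Quotient.map (fun x : B × P' => (x.1, x.2 * b.unop)) (by
    rintro x y ⟨q, hq, h1, h2⟩
    exact ⟨q, hq, h1, by dsimp only; rw [h2, mul_assoc]⟩)
  one_smul x := by
    induction x using Quotient.inductionOn with
    | h x => exact congrArg (Quotient.mk (bundleSetoid hQ B)) (Prod.ext rfl (mul_one x.2))
  mul_smul b c x := by
    induction x using Quotient.inductionOn with
    | h x =>
      exact congrArg (Quotient.mk (bundleSetoid hQ B))
        (Prod.ext rfl (mul_assoc x.2 c.unop b.unop).symm)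

/-- The bundle projection `B ×_Q P' → B / Q`, `[u, a] ↦ [u]`. -/
def proj : ExtendedBundle hQ B → FeffermanSpace hQ B :=
  Quotient.map Prod.fst (by
    rintro x y ⟨q, hq, h1, _⟩
    exact ⟨q, hq, h1⟩)

end ExtendedBundle

end Fefferman

/-- The data of a Fefferman-type construction: pairs `(G, P)` and `(G', P')` of Lie groups and
parabolic subgroups, and a Lie group homomorphism `i : G → G'` with injective derivative such that
the `G`-orbit of the origin in `G' / P'` is open. (The remaining condition `i⁻¹(P') ⊆ P` is kept
separate, as the construction of the bundles depends on it.) -/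
structure IsFeffermanData {E H : Type*} [NormedAddCommGroup E] [NormedSpace ℝ E]
    [TopologicalSpace H] (I : ModelWithCorners ℝ E H) {G : Type*} [TopologicalSpace G]
    [ChartedSpace H G] [Group G] {EP HP : Type*} [NormedAddCommGroup EP] [NormedSpace ℝ EP]
    [TopologicalSpace HP] (IP : ModelWithCorners ℝ EP HP) (P : Subgroup G) [ChartedSpace HP P]
    {E' H' : Type*} [NormedAddCommGroup E'] [NormedSpace ℝ E']
    [TopologicalSpace H'] (I' : ModelWithCorners ℝ E' H') {G' : Type*} [TopologicalSpace G']
    [ChartedSpace H' G'] [Group G'] {EP' HP' : Type*} [NormedAddCommGroup EP'] [NormedSpace ℝ EP']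
    [TopologicalSpace HP'] (IP' : ModelWithCorners ℝ EP' HP') (P' : Subgroup G')
    [ChartedSpace HP' P']
    [CompleteSpace E] [CompleteSpace EP] [CompleteSpace E'] [CompleteSpace EP']
    [LieGroup I ∞ G] [LieGroup IP ∞ P] [LieGroup I' ∞ G'] [LieGroup IP' ∞ P']
    (i : G →* G') : Prop where
  parabolic : IsParabolicSubgroup I IP P
  parabolic' : IsParabolicSubgroup I' IP' P'
  contMDiff : ContMDiff I I' ∞ i
  injective_lieMap : Function.Injective (lieMap I I' i)
  isOpen_orbit : IsOpen (Set.range fun g : G => (QuotientGroup.mk (i g) : G' ⧸ P'))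

/-- `θ'` is the Cartan connection on `B ×_Q P'` induced by the Cartan connection `θ` on `B`. The
Fefferman space `B / Q` and the bundle `B ×_Q P'` carry the quotient manifold structures, which are
characterized by the projections being smooth submersions, and `θ'` is the unique Cartan connection
of type `(G', P')` with `j^* θ' = i' ∘ θ`. -/
structure IsInducedGeometry {E H : Type*} [NormedAddCommGroup E] [NormedSpace ℝ E]
    [TopologicalSpace H] (I : ModelWithCorners ℝ E H) {G : Type*} [TopologicalSpace G]
    [ChartedSpace H G] [Group G] {P : Subgroup G}
    {E' H' : Type*} [NormedAddCommGroup E'] [NormedSpace ℝ E']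
    [TopologicalSpace H'] (I' : ModelWithCorners ℝ E' H') {G' : Type*} [TopologicalSpace G']
    [ChartedSpace H' G'] [Group G'] {EP' HP' : Type*} [NormedAddCommGroup EP'] [NormedSpace ℝ EP']
    [TopologicalSpace HP'] (IP' : ModelWithCorners ℝ EP' HP') {P' : Subgroup G'}
    [ChartedSpace HP' P'] {i : G →* G'} (hQ : P'.comap i ≤ P)
    {EB HB : Type*} [NormedAddCommGroup EB] [NormedSpace ℝ EB] [TopologicalSpace HB]
    (IB : ModelWithCorners ℝ EB HB) {B : Type*} [TopologicalSpace B] [ChartedSpace HB B]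
    [MulAction (P)ᵐᵒᵖ B]
    {EM' HM' : Type*} [NormedAddCommGroup EM'] [NormedSpace ℝ EM'] [TopologicalSpace HM']
    (IM' : ModelWithCorners ℝ EM' HM') [ChartedSpace HM' (FeffermanSpace hQ B)]
    {EB' HB' : Type*} [NormedAddCommGroup EB'] [NormedSpace ℝ EB'] [TopologicalSpace HB']
    (IB' : ModelWithCorners ℝ EB' HB') [ChartedSpace HB' (ExtendedBundle hQ B)]
    [IsManifold IB' ∞ (ExtendedBundle hQ B)]
    (θ : ∀ u : B, TangentSpace IB u →L[ℝ] GroupLieAlgebra I G)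
    (θ' : ∀ u : ExtendedBundle hQ B, TangentSpace IB' u →L[ℝ] GroupLieAlgebra I' G') : Prop where
  submersion_space : IsSmoothSubmersion IB IM' (FeffermanSpace.mk hQ : B → FeffermanSpace hQ B)
  submersion_bundle : IsSmoothSubmersion (IB.prod IP') IB'
    (ExtendedBundle.mk hQ : B × P' → ExtendedBundle hQ B)
  cartan : IsCartanConnection I' IP' (P := P') IB' θ'
  pullback : ∀ (u : B) (ξ : TangentSpace IB u),
    θ' (ExtendedBundle.incl hQ u)
      (mfderiv IB IB' (ExtendedBundle.incl hQ : B → ExtendedBundle hQ B) u ξ) =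
    lieMap I I' i (θ u ξ)

end Parabolic

end

/-!
For a point `[u, a]` of the extended bundle let `φ = Ad(a⁻¹) ∘ i' : 𝔤 → 𝔤'`. The map `u ↦ [u, a]`
pulls the induced Cartan connection `θ'` back to `φ ∘ θ` (`IsInducedGeometry.pullback_mk`), and `φ`
is a homomorphism of Lie algebras (`lieMap_lie`, `Ad_lie`). Naturality of the exterior derivative
therefore relates the curvature functions: `κ'([u, a])(φ X, φ Y) = φ (κ(u)(X, Y))`
(`curvatureFunction_of_pullback`). Both curvature functions are horizontal
(`curvatureFunction_eq_zero_of_mem`), and `𝔤' = φ(𝔤) + 𝔭'` (`IsInducedGeometry.exists_sub_mem`), so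
that `κ'` at `[u, a]` is determined by `κ` at `u` and has values in `𝔭'`. Also `φ⁻¹(𝔭') ⊆ 𝔭`, as
the extended bundle projects to the base of the original bundle
(`IsInducedGeometry.mem_of_map_mem`).

What remains is algebra (`codiff_eq_zero_of_related`). Since `𝔭'` comes from a `|1|`-grading,
`[𝔭'₊, 𝔤'] ⊆ 𝔭'`, and `∂₂^* κ' = 0` by horizontality. For `∂₁^* κ'` let `b = φ(x)` modulo `𝔭'`, and
let `B`, `B'` be the Killing forms of `𝔤`, `𝔤'`. The linear form `c ↦ B'(∑ⱼ [κ'(Xⱼ, b), Zⱼ], c)`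
vanishes on `𝔭'`, because `κ'` has values in `𝔭'` and `Zⱼ` is orthogonal to `𝔭'`. At `c = φ(y)` it
is, up to sign, the trace on `𝔤' / 𝔭'` of a map that `φ` relates to `v ↦ [κ(v, x), y]`. As the
latter vanishes on `𝔭`, cyclicity of the trace turns the value into the trace on `𝔤 / 𝔭` of
`v ↦ [κ(v, x), y]`, i.e. up to sign into `B(∑ᵢ [κ(Xᵢ, x), Zᵢ], y)`, which is zero as
`∂₁^* κ = 0`. The Killing form of `𝔤'` is non-degenerate
(`killingForm_nondegenerate_of_parabolic`), so `∂₁^* κ' = 0`.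

The facts about `dθ` rest on one formula (`exists_hasDerivAt_mextDeriv`): on the partial
derivatives of a map `σ` from a vector space to a manifold, `dθ` is the difference of the mixed
derivatives of `θ` along `σ`. Naturality is immediate from it. Naturality for the Maurer–Cartan
form, together with the Maurer–Cartan equation, shows that homomorphisms of Lie groups induce
homomorphisms of Lie algebras, and horizontality of the curvature follows by choosing `σ` adapted
to the principal action (`hasDerivAt_of_equivariant`).
-/

namespace Parabolic

/-! ### The Kostant codifferential under homomorphisms of Lie algebras -/

section Algebra

variable {L : Type*} [LieRing L] [LieAlgebra ℝ L]

theorem killingForm_lie_left (x y z : L) :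
    killingForm ℝ L ⁅x, y⁆ z = - killingForm ℝ L y ⁅x, z⁆ := by
  rw [← lie_skew, map_neg, LinearMap.neg_apply, LieModule.traceForm_apply_lie_apply]

/-- The Killing form of a simple Lie algebra with a parabolic subalgebra is non-degenerate. Cartan's
criterion is not needed: if the Killing form were zero, then the parabolic subalgebra would be the
whole algebra and would be equal to its nilradical, while a simple algebra is not nilpotent. -/
theorem killingForm_nondegenerate_of_parabolic (hL : LieAlgebra.IsSimple ℝ L)
    {K : Type*} [LieRing K] [LieAlgebra ℝ K] (f : K →ₗ⁅ℝ⁆ L) (hf : Function.Injective f)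
    (h : (nilradical K).toSubmodule.map (f : K →ₗ[ℝ] L) =
      killingPerp (LinearMap.range (f : K →ₗ[ℝ] L)))
    {x : L} (hx : ∀ y, killingForm ℝ L x y = 0) : x = 0 := by
  have hxr : x ∈ LieIdeal.killingCompl ℝ L ⊤ := by
    rw [LieIdeal.mem_killingCompl]
    intro y _
    rw [LieModule.traceForm_comm]
    exact hx y
  rcases hL.eq_bot_or_eq_top (LieIdeal.killingCompl ℝ L ⊤) with hr | hr
  · rw [hr] at hxr
    simpa using hxr
  exfalso
  have hzero : ∀ a b : L, killingForm ℝ L a b = 0 := by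
    intro a b
    have hb : b ∈ LieIdeal.killingCompl ℝ L ⊤ := by rw [hr]; exact LieSubmodule.mem_top b
    exact (LieIdeal.mem_killingCompl ℝ L ⊤).1 hb a (LieSubmodule.mem_top a)
  have hmap : (nilradical K).toSubmodule.map (f : K →ₗ[ℝ] L) = ⊤ := by
    rw [h, eq_top_iff]
    exact fun a _ b _ => hzero a b
  have hsurj : Function.Surjective f := by
    intro y
    have : y ∈ (nilradical K).toSubmodule.map (f : K →ₗ[ℝ] L) := by rw [hmap]; trivial
    obtain ⟨k, -, hk⟩ := this
    exact ⟨k, hk⟩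
  have key : ∀ J : LieIdeal ℝ K, LieRing.IsNilpotent J → J = ⊥ := by
    intro J hJ
    rcases hL.eq_bot_or_eq_top (J.map f) with hb | ht
    · rw [LieIdeal.map_eq_bot_iff, (LieHom.ker_eq_bot f).2 hf] at hb
      exact le_bot_iff.1 hb
    · exfalso
      let g : J →ₗ⁅ℝ⁆ L := f.comp J.incl
      have hg : Function.Surjective g := by
        intro y
        have hy : y ∈ J.map f := by rw [ht]; exact LieSubmodule.mem_top y
        obtain ⟨k, hk⟩ := LieIdeal.mem_map_of_surjective hsurj hy
        exact ⟨k, hk⟩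
      have : LieRing.IsNilpotent L := hg.lieAlgebra_isNilpotent
      have hnt : Nontrivial L := by
        by_contra hn
        rw [not_nontrivial_iff_subsingleton] at hn
        exact hL.non_abelian ⟨fun a b => Subsingleton.elim _ _⟩
      have hc : Nontrivial (LieAlgebra.center ℝ L) :=
        LieAlgebra.non_trivial_center_of_isNilpotent
      rw [LieAlgebra.center_eq_bot] at hc
      exact not_nontrivial _ hc
  have hbot : nilradical K = ⊥ := by
    rw [nilradical, sSup_eq_bot]
    exact key
  rw [hbot] at hmap
  have htop : (⊤ : Submodule ℝ L) = ⊥ := by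
    rw [← hmap]
    simp
  refine hL.non_abelian ⟨fun a b => ?_⟩
  have : ⁅a, b⁆ ∈ (⊤ : Submodule ℝ L) := trivial
  rw [htop] at this
  simpa using this

/-- For a `|1|`-grading the orthogonal complement of `𝔭 = 𝔤₀ ⊕ 𝔤₁` is contained in `𝔤₁`, since `𝔤ᵢ`
and `𝔤ⱼ` are orthogonal for `i + j ≠ 0`. Hence it maps the whole algebra to `𝔭`. -/
theorem lie_mem_of_mem_killingPerp [FiniteDimensional ℝ L]
    (hB : ∀ x : L, (∀ y, killingForm ℝ L x y = 0) → x = 0) {p : Submodule ℝ L}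
    (hp : IsOneGraded p) {z : L} (hz : z ∈ killingPerp p) (a : L) : ⁅z, a⁆ ∈ p := by
  obtain ⟨g, hint, hlie, hdeg, -, rfl⟩ := hp
  have horth : ∀ i j : ℤ, i + j ≠ 0 → ∀ x ∈ g i, ∀ y ∈ g j, killingForm ℝ L x y = 0 := by
    intro i j hij x hx y hy
    rw [killingForm_apply_apply]
    refine LinearMap.trace_eq_zero_of_mapsTo_ne hint (fun k => i + (j + k))
      (fun k hk => hij (by linarith)) fun k w hw => ?_
    exact hlie i (j + k) x hx _ (hlie j k y hy w hw)
  have hdecomp : ∀ x : L, ∃ u ∈ g (-1), ∃ v ∈ g 0, ∃ w ∈ g 1, x = u + v + w := by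
    intro x
    have hx : x ∈ g (-1) ⊔ g 0 ⊔ g 1 := by
      have htop : iSup g ≤ g (-1) ⊔ g 0 ⊔ g 1 := by
        refine iSup_le fun k => ?_
        by_cases hk : 1 < |k|
        · rw [hdeg k hk]; exact bot_le
        · have h1 := abs_le.1 (not_lt.1 hk)
          obtain ⟨h1, h2⟩ := h1
          interval_cases k
          · exact le_sup_of_le_left le_sup_left
          · exact le_sup_of_le_left le_sup_right
          · exact le_sup_right
      rw [hint.submodule_iSup_eq_top] at htop
      exact htop trivial
    obtain ⟨y, hy, w, hw, rfl⟩ := Submodule.mem_sup.1 hx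
    obtain ⟨u, hu, v, hv, rfl⟩ := Submodule.mem_sup.1 hy
    exact ⟨u, hu, v, hv, w, hw, rfl⟩
  obtain ⟨u, hu, v, hv, w, hw, rfl⟩ := hdecomp z
  have huv : u + v = 0 := by
    refine hB _ fun y => ?_
    obtain ⟨u', hu', v', hv', w', hw', rfl⟩ := hdecomp y
    have h0 := hz v' (Submodule.mem_sup_left hv')
    have h1 := hz w' (Submodule.mem_sup_right hw')
    have e1 := horth (-1) (-1) (by norm_num) u hu u' hu'
    have e2 := horth 0 (-1) (by norm_num) v hv u' hu'
    have e3 := horth 1 0 (by norm_num) w hw v' hv'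
    have e4 := horth 1 1 (by norm_num) w hw w' hw'
    simp only [map_add, LinearMap.add_apply] at h0 h1 ⊢
    linarith
  rw [huv, zero_add]
  obtain ⟨u', hu', v', hv', w', hw', rfl⟩ := hdecomp a
  rw [lie_add, lie_add]
  refine Submodule.add_mem _ (Submodule.add_mem _ ?_ ?_) ?_
  · exact Submodule.mem_sup_left (by simpa using hlie 1 (-1) w hw u' hu')
  · exact Submodule.mem_sup_right (by simpa using hlie 1 0 w hw v' hv')
  · have h2 := hlie 1 1 w hw w' hw'
    rw [hdeg (1 + 1) (by norm_num)] at h2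
    rw [(Submodule.mem_bot ℝ).1 h2]
    exact Submodule.zero_mem _

/-- A dual frame represents the identity modulo `𝔭`. -/
theorem IsDualFrame.sub_sum_mem {p : Submodule ℝ L} {n : ℕ} {X Z : Fin n → L}
    (h : IsDualFrame p (killingPerp p) X Z) (v : L) :
    v - ∑ i, killingForm ℝ L (Z i) v • X i ∈ p := by
  have hv : p.mkQ v ∈ Submodule.span ℝ (Set.range fun i => p.mkQ (X i)) := by
    rw [h.span_eq_top]; trivial
  obtain ⟨c, hc⟩ := (Submodule.mem_span_range_iff_exists_fun ℝ).1 hv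
  have hq : v - ∑ i, c i • X i ∈ p := by
    rw [← Submodule.Quotient.mk_eq_zero, ← Submodule.mkQ_apply, map_sub, map_sum, ← hc]
    simp
  have hcoef : ∀ k, killingForm ℝ L (Z k) v = c k := by
    intro k
    have h0 := h.mem_nilradical k _ hq
    rw [map_sub, map_sum, sub_eq_zero] at h0
    rw [h0]
    simp [h.dual]
  simpa only [hcoef] using hq

theorem exists_isDualFrame [FiniteDimensional ℝ L]
    (hB : ∀ x : L, (∀ y, killingForm ℝ L x y = 0) → x = 0) (p : Submodule ℝ L) :
    ∃ (n : ℕ) (X Z : Fin n → L), IsDualFrame p (killingPerp p) X Z := by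
  let b := Module.finBasis ℝ (L ⧸ p)
  choose X hX using fun i => p.mkQ_surjective (b i)
  have hinj : Function.Injective (killingForm ℝ L) := by
    rw [injective_iff_map_eq_zero]
    exact fun x hx => hB x fun y => by rw [hx, LinearMap.zero_apply]
  have hsurj : Function.Surjective (killingForm ℝ L) :=
    (LinearMap.injective_iff_surjective_of_finrank_eq_finrank
      (Subspace.dual_finrank_eq (K := ℝ) (V := L)).symm).1 hinj
  choose Z hZ using fun i => hsurj ((b.coord i).comp p.mkQ)
  refine ⟨_, X, Z, ?_, ?_, ?_, ?_⟩
  · simp only [hX]; exact b.linearIndependent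
  · simp only [hX]; exact b.span_eq
  · intro i y hy
    rw [hZ i, LinearMap.comp_apply, Submodule.mkQ_apply, (Submodule.Quotient.mk_eq_zero p).2 hy,
      map_zero]
  · intro i j
    rw [hZ i, LinearMap.comp_apply, hX j, Module.Basis.coord_apply, Module.Basis.repr_self,
      Finsupp.single_apply]
    simp only [eq_comm]

/-- The algebraic core. Let `f : 𝔤 → 𝔤'` be a homomorphism of Lie algebras such that
`𝔤' = f(𝔤) + 𝔭'` and `f⁻¹(𝔭') ⊆ 𝔭`, and let `κ`, `κ'` be horizontal two-cochains that are related by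
`f`, the values of `κ'` being in `𝔭'`. Then `∂₁^* κ = 0` implies `∂^* κ' = 0`: the second
summand of `∂^* κ'` vanishes because of the `|1|`-grading, and the Killing product of
the first summand with `f(y)` is, up to sign, the trace of `[κ'(·, f(a)), f(y)]` on `𝔤' / 𝔭'`,
which is equal to the trace of `[κ(·, a), y]` on `𝔤 / 𝔭`, i.e. to a Killing product
with `∂₁^* κ(a)`. -/
theorem codiff_eq_zero_of_related [FiniteDimensional ℝ L]
    {L' : Type*} [LieRing L'] [LieAlgebra ℝ L'] [FiniteDimensional ℝ L']
    (hB : ∀ x : L, (∀ y, killingForm ℝ L x y = 0) → x = 0)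
    (hB' : ∀ x : L', (∀ y, killingForm ℝ L' x y = 0) → x = 0)
    {p : Submodule ℝ L} {p' : Submodule ℝ L'} (hp' : IsOneGraded p')
    (hlie : ∀ x ∈ p', ∀ y ∈ p', ⁅x, y⁆ ∈ p')
    (f : L →ₗ[ℝ] L') (hf : ∀ x y, f ⁅x, y⁆ = ⁅f x, f y⁆)
    (hspan : ∀ x : L', ∃ y : L, x - f y ∈ p') (hcomap : ∀ x, f x ∈ p' → x ∈ p)
    (κ : L →ₗ[ℝ] L →ₗ[ℝ] L) (κ' : L' →ₗ[ℝ] L' →ₗ[ℝ] L')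
    (hκ : ∀ x ∈ p, ∀ y, κ x y = 0)
    (hκl : ∀ x ∈ p', ∀ y, κ' x y = 0) (hκr : ∀ y ∈ p', ∀ x, κ' x y = 0)
    (hrel : ∀ x y, κ' (f x) (f y) = f (κ x y)) (hval : ∀ x y, f (κ x y) ∈ p')
    (hone : ∀ (n : ℕ) (X Z : Fin n → L), IsDualFrame p (killingPerp p) X Z →
      ∀ a, codiffOne X Z (fun x y => κ x y) a = 0)
    {n : ℕ} {X Z : Fin n → L'} (hXZ : IsDualFrame p' (killingPerp p') X Z) (a : L') :
    codiff X Z (fun x y => κ' x y) a = 0 := by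
  have htwo : codiffTwo X Z (fun x y => κ' x y) a = 0 :=
    Finset.sum_eq_zero fun i _ =>
      hκr _ (lie_mem_of_mem_killingPerp hB' hp' (hXZ.mem_nilradical i) a) _
  rw [codiff, htwo, add_zero, codiffOne]
  obtain ⟨a₀, ha₀⟩ := hspan a
  choose x hx using fun j => hspan (X j)
  have hval' : ∀ j, κ' (X j) a = f (κ (x j) a₀) := by
    intro j
    rw [← hrel, ← sub_eq_zero]
    have e : κ' (X j) a - κ' (f (x j)) (f a₀) =
        κ' (X j - f (x j)) a + κ' (f (x j)) (a - f a₀) := by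
      simp only [map_sub, LinearMap.sub_apply]; abel
    rw [e, hκl _ (hx j), hκr _ ha₀, add_zero]
  have hzero : ∑ j, ⁅κ' (X j) a, Z j⁆ = 0 := by
    refine hB' _ fun y' => ?_
    obtain ⟨y, hy⟩ := hspan y'
    -- `κ'` has values in `𝔭'`, to which the `Z j` are orthogonal, so only `y'` modulo `𝔭'` matters
    have hpart : ∀ q ∈ p', killingForm ℝ L' (∑ j, ⁅κ' (X j) a, Z j⁆) q = 0 := by
      intro q hq
      rw [map_sum, LinearMap.sum_apply]
      refine Finset.sum_eq_zero fun j _ => ?_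
      rw [killingForm_lie_left, hXZ.mem_nilradical j _ (hlie _ (hval' j ▸ hval _ _) q hq), neg_zero]
    rw [← sub_add_cancel y' (f y), map_add, hpart _ hy, zero_add, map_sum, LinearMap.sum_apply]
    obtain ⟨m, X₀, Z₀, hF⟩ := exists_isDualFrame hB p
    -- the endomorphism `v ↦ ⁅κ v a₀, y⁆`, which factors through `L / p`
    let T : L →ₗ[ℝ] L := -(LieModule.toEnd ℝ L L y ∘ₗ κ.flip a₀)
    have hT : ∀ v, T v = ⁅κ v a₀, y⁆ := fun v => by
      simp only [T, LinearMap.neg_apply, LinearMap.comp_apply, LinearMap.flip_apply,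
        LieModule.toEnd_apply_apply, lie_skew]
    have hTp : ∀ v ∈ p, T v = 0 := fun v hv => by rw [hT, hκ v hv, zero_lie]
    have hTsum : ∀ v, T v = ∑ i, killingForm ℝ L (Z₀ i) v • T (X₀ i) := by
      intro v
      have h0 := hTp _ (hF.sub_sum_mem v)
      rw [map_sub, sub_eq_zero] at h0
      rw [h0, map_sum]
      simp only [map_smul]
    -- modulo `p`, every `v` is the combination of the `x j` given by the coordinates of `f v`
    have hcoord : ∀ v, v - ∑ j, killingForm ℝ L' (Z j) (f v) • x j ∈ p := by
      intro v
      refine hcomap _ ?_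
      have e : f (v - ∑ j, killingForm ℝ L' (Z j) (f v) • x j) =
          (f v - ∑ j, killingForm ℝ L' (Z j) (f v) • X j) +
            ∑ j, killingForm ℝ L' (Z j) (f v) • (X j - f (x j)) := by
        rw [map_sub, map_sum]
        simp only [map_smul, smul_sub, Finset.sum_sub_distrib]
        abel
      rw [e]
      exact Submodule.add_mem _ (hXZ.sub_sum_mem (f v))
        (Submodule.sum_mem _ fun j _ => Submodule.smul_mem _ _ (hx j))
    have hstep : ∀ j, killingForm ℝ L' ⁅κ' (X j) a, Z j⁆ (f y) =
        -∑ i, killingForm ℝ L (Z₀ i) (x j) * killingForm ℝ L' (Z j) (f (T (X₀ i))) := by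
      intro j
      rw [killingForm_lie_left, hval' j, ← hf, ← hT, hTsum (x j), map_sum, map_sum]
      simp only [map_smul, smul_eq_mul]
    simp only [hstep, Finset.sum_neg_distrib]
    -- cyclicity of the trace: interchanging the sums gives the trace of `T` on `L / p`
    rw [Finset.sum_comm, neg_eq_zero]
    have htr : ∀ i, ∑ j, killingForm ℝ L (Z₀ i) (x j) * killingForm ℝ L' (Z j) (f (T (X₀ i))) =
        -killingForm ℝ L ⁅κ (X₀ i) a₀, Z₀ i⁆ y := by
      intro i
      have h0 := hF.mem_nilradical i _ (hcoord (T (X₀ i)))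
      rw [map_sub, map_sum, sub_eq_zero] at h0
      rw [killingForm_lie_left, neg_neg, ← hT, h0]
      simp only [map_smul, smul_eq_mul, mul_comm]
    simp only [htr, Finset.sum_neg_distrib]
    have h1 := hone m X₀ Z₀ hF a₀
    rw [codiffOne, smul_eq_zero_iff_right two_ne_zero] at h1
    rw [← LinearMap.sum_apply, ← map_sum, h1, map_zero, LinearMap.zero_apply, neg_zero]
  rw [hzero, smul_zero]

end Algebra

/-! ### The exterior derivative along parametrized surfaces -/

section Forms

open Set Filter

variable {E H : Type*} [NormedAddCommGroup E] [NormedSpace ℝ E] [TopologicalSpace H]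
  {I : ModelWithCorners ℝ E H} {M : Type*} [TopologicalSpace M] [ChartedSpace H M]
  {F : Type*} [NormedAddCommGroup F] [NormedSpace ℝ F]

/-- Transport of a one-form along an equality of base points. The tangent spaces are, by definition,
all equal to the model space, which gives a meaning to the equation. -/
theorem form_congr (θ : ∀ u : M, TangentSpace I u →L[ℝ] F) {u v : M} (h : u = v) :
    (θ u : E →L[ℝ] F) = (θ v : E →L[ℝ] F) := by
  subst h; rfl

variable (I) in
/-- The expression of a one-form in the preferred chart at `u`, as a function with values in
continuous linear maps. -/
noncomputable def chartForm (θ : ∀ u : M, TangentSpace I u →L[ℝ] F) (u : M) (x : E) : E →L[ℝ] F :=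
  (θ ((extChartAt I u).symm x)).comp (mfderiv 𝓘(ℝ, E) I (extChartAt I u).symm x)

theorem formInChart_eq [I.Boundaryless] (θ : ∀ u : M, TangentSpace I u →L[ℝ] F) (u : M) :
    formInChart I θ u = fun x =>
      ContinuousAlternatingMap.ofSubsingleton ℝ E F (0 : Fin 1) (chartForm I θ u x) := by
  funext x
  simp only [formInChart, chartForm, I.range_eq_univ, mfderivWithin_univ]

theorem differentiableAt_chartForm [I.Boundaryless] [FiniteDimensional ℝ E] [IsManifold I ∞ M]
    {θ : ∀ u : M, TangentSpace I u →L[ℝ] F} (hθ : IsSmoothForm I θ) (u : M) :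
    DifferentiableAt ℝ (chartForm I θ u) (extChartAt I u u) := by
  set s := (extChartAt I u).target
  have hs : IsOpen s := isOpen_extChartAt_target u
  have hx : extChartAt I u u ∈ s := mem_extChartAt_target u
  have key : ContDiffOn ℝ ∞ (chartForm I θ u) s := by
    rw [contDiffOn_clm_apply]
    intro w
    have h1 : ContMDiffOn 𝓘(ℝ, E).tangent I.tangent ∞
        (tangentMapWithin 𝓘(ℝ, E) I (extChartAt I u).symm s)
        (Bundle.TotalSpace.proj ⁻¹' s) :=
      (contMDiffOn_extChartAt_symm u).contMDiffOn_tangentMapWithin (m := ∞) (n := ∞) le_rfl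
        hs.uniqueMDiffOn
    have h2 : ContMDiff 𝓘(ℝ, E) 𝓘(ℝ, E).tangent ∞
        (fun x : E => (⟨x, w⟩ : TangentBundle 𝓘(ℝ, E) E)) :=
      contMDiff_vectorSpace_iff_contDiff.2 contDiff_const
    have h3 := hθ.comp_contMDiffOn (h1.comp (h2.contMDiffOn (s := s)) fun x hx => hx)
    rw [contMDiffOn_iff_contDiffOn] at h3
    refine h3.congr fun x hx => ?_
    simp only [Function.comp_apply, tangentMapWithin, chartForm]
    rw [mfderivWithin_of_isOpen hs hx]
    rfl
  exact (key.contDiffAt (hs.mem_nhds hx)).differentiableAt (by simp)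

/-- In the preferred chart, the exterior derivative is the skew part of the Fréchet derivative. -/
theorem mextDeriv_eq [I.Boundaryless] {θ : ∀ u : M, TangentSpace I u →L[ℝ] F} {u : M}
    (h : DifferentiableAt ℝ (chartForm I θ u) (extChartAt I u u)) (v w : TangentSpace I u) :
    mextDeriv I θ u v w =
      fderiv ℝ (chartForm I θ u) (extChartAt I u u) (mfderiv I 𝓘(ℝ, E) (extChartAt I u) u v)
        (mfderiv I 𝓘(ℝ, E) (extChartAt I u) u w) -
      fderiv ℝ (chartForm I θ u) (extChartAt I u u) (mfderiv I 𝓘(ℝ, E) (extChartAt I u) u w)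
        (mfderiv I 𝓘(ℝ, E) (extChartAt I u) u v) := by
  have hd : DifferentiableAt ℝ (formInChart I θ u) (extChartAt I u u) := by
    rw [formInChart_eq]
    exact ((ContinuousAlternatingMap.ofSubsingletonLIE (𝕜 := ℝ) (E := E) (F := F)
      (0 : Fin 1)).toContinuousLinearEquiv.toContinuousLinearMap.differentiableAt).comp _ h
  have hf : ∀ y z : E, fderiv ℝ (fun x => formInChart I θ u x ![y]) (extChartAt I u u) z =
      fderiv ℝ (chartForm I θ u) (extChartAt I u u) z y := by
    intro y z
    have : (fun x => formInChart I θ u x ![y]) = fun x => chartForm I θ u x y := by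
      funext x
      rw [formInChart_eq]
      rfl
    rw [this, fderiv_clm_apply h (differentiableAt_const y)]
    simp
  have e0 : ∀ v' w' : E, (Fin.removeNth 0 ![v', w'] : Fin 1 → E) = ![w'] := by
    intro v' w'; ext j; fin_cases j; rfl
  have e1 : ∀ v' w' : E, (Fin.removeNth 1 ![v', w'] : Fin 1 → E) = ![v'] := by
    intro v' w'; ext j; fin_cases j; rfl
  have hext : ∀ v' w' : E, extDeriv (formInChart I θ u) (extChartAt I u u) ![v', w'] =
      fderiv ℝ (chartForm I θ u) (extChartAt I u u) v' w' -
        fderiv ℝ (chartForm I θ u) (extChartAt I u u) w' v' := by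
    intro v' w'
    rw [extDeriv_apply hd, Fin.sum_univ_two, e0, e1, hf, hf]
    simp [sub_eq_add_neg]
  rw [mextDeriv, I.range_eq_univ, extDerivWithin_univ]
  exact hext _ _

variable {V : Type*} [NormedAddCommGroup V] [NormedSpace ℝ V]

theorem hasDerivAt_form_comp {α : E → E →L[ℝ] F} {σ : V → E}
    (hα : DifferentiableAt ℝ α (σ 0)) (hσ : ContDiffAt ℝ 2 σ 0) (e e' : V) :
    HasDerivAt (fun t : ℝ => α (σ (t • e)) (fderiv ℝ σ (t • e) e'))
      (fderiv ℝ α (σ 0) (fderiv ℝ σ 0 e) (fderiv ℝ σ 0 e') +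
        α (σ 0) (fderiv ℝ (fderiv ℝ σ) 0 e e')) 0 := by
  have h0 : (0 : ℝ) • e = 0 := zero_smul ℝ e
  have hl : HasDerivAt (fun t : ℝ => t • e) e 0 := by
    simpa using (hasDerivAt_id (0 : ℝ)).smul_const e
  have h1 : HasDerivAt (fun t : ℝ => σ (t • e)) (fderiv ℝ σ 0 e) 0 := by
    have := (hσ.differentiableAt (by simp)).hasFDerivAt
    rw [← h0] at this
    simpa only [h0, Function.comp_def] using this.comp_hasDerivAt (0 : ℝ) hl
  have h2 : HasDerivAt (fun t : ℝ => α (σ (t • e))) (fderiv ℝ α (σ 0) (fderiv ℝ σ 0 e)) 0 := by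
    have := hα.hasFDerivAt
    rw [← h0] at this
    simpa only [h0, Function.comp_def] using this.comp_hasDerivAt (0 : ℝ) h1
  have h3 : HasDerivAt (fun t : ℝ => fderiv ℝ σ (t • e)) (fderiv ℝ (fderiv ℝ σ) 0 e) 0 := by
    have := ((hσ.fderiv_right (m := 1) (by norm_num)).differentiableAt (by simp)).hasFDerivAt
    rw [← h0] at this
    simpa only [h0, Function.comp_def] using this.comp_hasDerivAt (0 : ℝ) hl
  have h4 : HasDerivAt (fun t : ℝ => fderiv ℝ σ (t • e) e') (fderiv ℝ (fderiv ℝ σ) 0 e e') 0 := by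
    simpa using h3.clm_apply (hasDerivAt_const (0 : ℝ) e')
  simpa only [h0] using h2.clm_apply h4

/-- The exterior derivative of a one-form on the tangent vectors of a parametrized surface: for
`σ : V → M` and `e, e' ∈ V` it is `∂ₑ (θ(∂ₑ' σ)) - ∂ₑ' (θ(∂ₑ σ))`, as the second derivatives of `σ`
in a chart are symmetric. -/
theorem exists_hasDerivAt_mextDeriv [I.Boundaryless] [FiniteDimensional ℝ E] [IsManifold I ∞ M]
    {θ : ∀ u : M, TangentSpace I u →L[ℝ] F} (hθ : IsSmoothForm I θ) {σ : V → M}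
    (hσ : ContMDiffAt 𝓘(ℝ, V) I 2 σ 0) (e e' : V) :
    ∃ a b : F,
      HasDerivAt (fun t : ℝ => θ (σ (t • e)) (mfderiv 𝓘(ℝ, V) I σ (t • e) e')) a 0 ∧
      HasDerivAt (fun t : ℝ => θ (σ (t • e')) (mfderiv 𝓘(ℝ, V) I σ (t • e') e)) b 0 ∧
      mextDeriv I θ (σ 0) (mfderiv 𝓘(ℝ, V) I σ 0 e) (mfderiv 𝓘(ℝ, V) I σ 0 e') = a - b := by
  set u := σ 0 with hu
  let τ : V → E := fun p => extChartAt I u (σ p)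
  have hτ : ContDiffAt ℝ 2 τ 0 := by
    rw [← contMDiffAt_iff_contDiffAt]
    exact (contMDiffAt_extChartAt (I := I) (x := u)).comp (0 : V) hσ
  have hd : DifferentiableAt ℝ (chartForm I θ u) (τ 0) := differentiableAt_chartForm hθ u
  have hnear : ∀ᶠ p in 𝓝 (0 : V), ∀ w : V,
      θ (σ p) (mfderiv 𝓘(ℝ, V) I σ p w) = chartForm I θ u (τ p) (fderiv ℝ τ p w) := by
    have h1 : ∀ᶠ p in 𝓝 (0 : V), σ p ∈ (extChartAt I u).source :=
      hσ.continuousAt.eventually (extChartAt_source_mem_nhds (I := I) u)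
    have h2 : ∀ᶠ p in 𝓝 (0 : V), ContDiffAt ℝ 2 τ p := hτ.eventually (by simp)
    filter_upwards [eventually_eventually_nhds.2 h1, h2] with p hp hp2 w
    have heq : σ =ᶠ[𝓝 p] fun q => (extChartAt I u).symm (τ q) := by
      filter_upwards [hp] with q hq
      exact ((extChartAt I u).left_inv hq).symm
    have hmem : τ p ∈ (extChartAt I u).target := (extChartAt I u).map_source hp.self_of_nhds
    have hψ : MDifferentiableAt 𝓘(ℝ, E) I (extChartAt I u).symm (τ p) :=
      ((contMDiffOn_extChartAt_symm (n := 2) u).contMDiffAt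
        ((isOpen_extChartAt_target u).mem_nhds hmem)).mdifferentiableAt (by simp)
    have hτp : MDifferentiableAt 𝓘(ℝ, V) 𝓘(ℝ, E) τ p :=
      (hp2.differentiableAt (by simp)).mdifferentiableAt
    have hmf := heq.mfderiv_eq (I := 𝓘(ℝ, V)) (I' := I)
    have hcomp := mfderiv_comp p hψ hτp
    have e1 : (mfderiv 𝓘(ℝ, V) I σ p w : E) =
        mfderiv 𝓘(ℝ, E) I (extChartAt I u).symm (τ p) (fderiv ℝ τ p w) := by
      rw [hmf]
      change (mfderiv 𝓘(ℝ, V) I ((extChartAt I u).symm ∘ τ) p) w = _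
      rw [hcomp, mfderiv_eq_fderiv]
      rfl
    have e2 : (θ (σ p) : E →L[ℝ] F) = θ ((extChartAt I u).symm (τ p)) :=
      form_congr θ heq.self_of_nhds
    change (θ (σ p) : E →L[ℝ] F) (mfderiv 𝓘(ℝ, V) I σ p w : E) = _
    rw [e1, e2]
    rfl
  have hline : ∀ d : V, ∀ᶠ t : ℝ in 𝓝 0, ∀ w : V,
      θ (σ (t • d)) (mfderiv 𝓘(ℝ, V) I σ (t • d) w) =
        chartForm I θ u (τ (t • d)) (fderiv ℝ τ (t • d) w) := by
    intro d
    have hc : Tendsto (fun t : ℝ => t • d) (𝓝 0) (𝓝 0) := by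
      have : ContinuousAt (fun t : ℝ => t • d) 0 := by fun_prop
      simpa [ContinuousAt] using this
    exact hc.eventually hnear
  have hchart : ∀ w : V, mfderiv I 𝓘(ℝ, E) (extChartAt I u) u (mfderiv 𝓘(ℝ, V) I σ 0 w) =
      fderiv ℝ τ 0 w := by
    intro w
    rw [← mfderiv_eq_fderiv]
    have := mfderiv_comp (0 : V) (mdifferentiableAt_extChartAt (I := I) (mem_chart_source H u))
      (hσ.mdifferentiableAt (by simp))
    exact (DFunLike.congr_fun this w).symm
  refine ⟨_, _, (hasDerivAt_form_comp hd hτ e e').congr_of_eventuallyEq ?_,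
    (hasDerivAt_form_comp hd hτ e' e).congr_of_eventuallyEq ?_, ?_⟩
  · filter_upwards [hline e] with t ht using ht e'
  · filter_upwards [hline e'] with t ht using ht e
  · rw [mextDeriv_eq hd, hchart, hchart, (hτ.isSymmSndFDerivAt (by simp)).eq e e']
    change fderiv ℝ (chartForm I θ u) (τ 0) _ _ - _ = _
    abel

end Forms

/-! ### Naturality of the exterior derivative -/

section Forms

open Set Filter

variable {E H : Type*} [NormedAddCommGroup E] [NormedSpace ℝ E] [TopologicalSpace H]
  {I : ModelWithCorners ℝ E H} {M : Type*} [TopologicalSpace M] [ChartedSpace H M]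
  {E' H' : Type*} [NormedAddCommGroup E'] [NormedSpace ℝ E'] [TopologicalSpace H']
  {I' : ModelWithCorners ℝ E' H'} {M' : Type*} [TopologicalSpace M'] [ChartedSpace H' M']
  {F : Type*} [NormedAddCommGroup F] [NormedSpace ℝ F]
  {F' : Type*} [NormedAddCommGroup F'] [NormedSpace ℝ F']

variable (I) in
/-- A local parametrization of a manifold around a given point. In the trivialization of the tangent
space that is built into `TangentSpace`, its derivative at the origin is the identity. -/
theorem exists_parametrization [I.Boundaryless] [IsManifold I ∞ M] (u : M) :
    ∃ σ : E → M, ContMDiffAt 𝓘(ℝ, E) I ∞ σ 0 ∧ σ 0 = u ∧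
      ∀ v : E, (mfderiv 𝓘(ℝ, E) I σ 0 v : E) = v := by
  have hmem : (extChartAt I u).target ∈ 𝓝 (extChartAt I u u + 0) := by
    rw [add_zero]
    exact (isOpen_extChartAt_target u).mem_nhds (mem_extChartAt_target u)
  have hψ : ContMDiffAt 𝓘(ℝ, E) I ∞ (extChartAt I u).symm (extChartAt I u u + 0) :=
    (contMDiffOn_extChartAt_symm u).contMDiffAt hmem
  have htr : ContMDiff 𝓘(ℝ, E) 𝓘(ℝ, E) ∞ (fun x : E => extChartAt I u u + x) := by
    rw [contMDiff_iff_contDiff]; fun_prop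
  refine ⟨(extChartAt I u).symm ∘ fun x => extChartAt I u u + x,
    hψ.comp (0 : E) htr.contMDiffAt, ?_, fun v => ?_⟩
  · rw [Function.comp_apply, add_zero, (extChartAt I u).left_inv (mem_extChartAt_source u)]
  · have hid : ∀ y : E, y = extChartAt I u u → ∀ w : E,
        (mfderiv 𝓘(ℝ, E) I (extChartAt I u).symm y w : E) = w := by
      rintro _ rfl w
      have h := mfderivWithin_range_extChartAt_symm (I := I) (x := u)
      rw [I.range_eq_univ, mfderivWithin_univ] at h
      rw [h]
      rfl
    rw [mfderiv_comp (0 : E) (hψ.mdifferentiableAt (by simp))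
      (htr.contMDiffAt.mdifferentiableAt (by simp))]
    have h2 : mfderiv 𝓘(ℝ, E) 𝓘(ℝ, E) (fun x : E => extChartAt I u u + x) 0 v = v := by
      rw [mfderiv_eq_fderiv, fderiv_const_add, fderiv_fun_id]
      rfl
    change (mfderiv 𝓘(ℝ, E) I (extChartAt I u).symm (extChartAt I u u + 0)
      (mfderiv 𝓘(ℝ, E) 𝓘(ℝ, E) (fun x : E => extChartAt I u u + x) 0 v) : E) = v
    rw [h2]
    exact hid _ (add_zero _) v

variable (I) in
theorem exists_curve [I.Boundaryless] [IsManifold I ∞ M] (u : M) (v : E) :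
    ∃ c : ℝ → M, ContMDiffAt 𝓘(ℝ, ℝ) I ∞ c 0 ∧ c 0 = u ∧
      (mfderiv 𝓘(ℝ, ℝ) I c 0 (1 : ℝ) : E) = v := by
  obtain ⟨σ, hσ, h0, hv⟩ := exists_parametrization I u
  have hl : ContMDiff 𝓘(ℝ, ℝ) 𝓘(ℝ, E) ∞ (fun t : ℝ => t • v) := by
    rw [contMDiff_iff_contDiff]; fun_prop
  have hσ' : ContMDiffAt 𝓘(ℝ, E) I ∞ σ ((fun t : ℝ => t • v) 0) := by simpa using hσ
  refine ⟨σ ∘ fun t => t • v, hσ'.comp (0 : ℝ) hl.contMDiffAt, by simpa using h0, ?_⟩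
  rw [mfderiv_comp (0 : ℝ) (hσ'.mdifferentiableAt (by simp))
    (hl.contMDiffAt.mdifferentiableAt (by simp))]
  have h2 : (mfderiv 𝓘(ℝ, ℝ) 𝓘(ℝ, E) (fun t : ℝ => t • v) 0 (1 : ℝ) : E) = v := by
    rw [mfderiv_eq_fderiv]
    have := ((hasDerivAt_id (0 : ℝ)).smul_const v).deriv
    rw [one_smul] at this
    exact this
  have hid : ∀ y : E, y = 0 → ∀ w : E, (mfderiv 𝓘(ℝ, E) I σ y w : E) = w := by
    rintro _ rfl w
    exact hv w
  change (mfderiv 𝓘(ℝ, E) I σ ((0 : ℝ) • v)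
    (mfderiv 𝓘(ℝ, ℝ) 𝓘(ℝ, E) (fun t : ℝ => t • v) 0 (1 : ℝ) : E) : E) = v
  rw [h2]
  exact hid _ (zero_smul ℝ v) v

/-- Naturality of the exterior derivative under pullback. -/
theorem mextDeriv_of_pullback [I.Boundaryless] [FiniteDimensional ℝ E] [IsManifold I ∞ M]
    [I'.Boundaryless] [FiniteDimensional ℝ E'] [IsManifold I' ∞ M']
    {θ : ∀ u : M, TangentSpace I u →L[ℝ] F} (hθ : IsSmoothForm I θ)
    {θ' : ∀ u : M', TangentSpace I' u →L[ℝ] F'} (hθ' : IsSmoothForm I' θ')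
    {f : M → M'} (hf : ContMDiff I I' ∞ f) (T : F →L[ℝ] F')
    (hpull : ∀ (u : M) (v : TangentSpace I u), θ' (f u) (mfderiv I I' f u v) = T (θ u v))
    (u : M) (v w : TangentSpace I u) :
    mextDeriv I' θ' (f u) (mfderiv I I' f u v) (mfderiv I I' f u w) =
      T (mextDeriv I θ u v w) := by
  obtain ⟨σ, hσ, rfl, hv⟩ := exists_parametrization I u
  have hσ2 : ContMDiffAt 𝓘(ℝ, E) I 2 σ 0 := hσ.of_le ENat.LEInfty.out
  have hfσ : ContMDiffAt 𝓘(ℝ, E) I' 2 (f ∘ σ) 0 :=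
    (hf.contMDiffAt.of_le ENat.LEInfty.out).comp (0 : E) hσ2
  have hnear : ∀ᶠ p in 𝓝 (0 : E), ∀ e : E,
      (mfderiv 𝓘(ℝ, E) I' (f ∘ σ) p e : E') = mfderiv I I' f (σ p) (mfderiv 𝓘(ℝ, E) I σ p e) := by
    filter_upwards [(contMDiffAt_iff_contMDiffAt_nhds (by simp)).1 hσ2] with p hp e
    rw [mfderiv_comp p (hf.contMDiffAt.mdifferentiableAt (by simp))
      (hp.mdifferentiableAt (by simp))]
    rfl
  have hline : ∀ d e : E, ∀ᶠ t : ℝ in 𝓝 0,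
      θ' ((f ∘ σ) (t • d)) (mfderiv 𝓘(ℝ, E) I' (f ∘ σ) (t • d) e) =
        T (θ (σ (t • d)) (mfderiv 𝓘(ℝ, E) I σ (t • d) e)) := by
    intro d e
    have hc : Tendsto (fun t : ℝ => t • d) (𝓝 0) (𝓝 0) := by
      have : ContinuousAt (fun t : ℝ => t • d) 0 := by fun_prop
      simpa [ContinuousAt] using this
    filter_upwards [hc.eventually hnear] with t ht
    rw [← hpull]
    exact congrArg (θ' (f (σ (t • d))) : E' →L[ℝ] F') (ht e)
  obtain ⟨a, b, ha, hb, hab⟩ := exists_hasDerivAt_mextDeriv hθ hσ2 (v : E) (w : E)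
  obtain ⟨a', b', ha', hb', hab'⟩ := exists_hasDerivAt_mextDeriv hθ' hfσ (v : E) (w : E)
  have h1 : a' = T a :=
    ha'.unique ((T.hasFDerivAt.comp_hasDerivAt (0 : ℝ) ha).congr_of_eventuallyEq (hline v w))
  have h2 : b' = T b :=
    hb'.unique ((T.hasFDerivAt.comp_hasDerivAt (0 : ℝ) hb).congr_of_eventuallyEq (hline w v))
  have e1 : ∀ e : E, (mfderiv 𝓘(ℝ, E) I' (f ∘ σ) 0 e : E') = mfderiv I I' f (σ 0) e := by
    intro e
    rw [hnear.self_of_nhds e]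
    exact congrArg (mfderiv I I' f (σ 0) : E → E') (hv e)
  have e2 : mextDeriv I θ (σ 0) v w = a - b := by
    rw [← hab]
    exact (congrArg₂ (fun x y : E => mextDeriv I θ (σ 0) x y) (hv v) (hv w)).symm
  rw [e2, map_sub, ← h1, ← h2, ← hab']
  exact (congrArg₂ (fun x y : E' => mextDeriv I' θ' (f (σ 0)) x y) (e1 v) (e1 w)).symm

variable {EK HK : Type*} [NormedAddCommGroup EK] [NormedSpace ℝ EK] [TopologicalSpace HK]
  {IK : ModelWithCorners ℝ EK HK} {K : Type*} [TopologicalSpace K] [ChartedSpace HK K]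

/-- Let `K` act on `M` such that the one-form `θ` is constant on the generators of the action and
is transformed by `ρ`. Then `dθ(ζ, ξ)`, for a generator `ζ`, is the derivative of `ρ(·) θ(ξ)` in the
direction of `ζ`. This is the surface formula for `σ(s, t) = c(t) · γ(s)`. -/
theorem hasDerivAt_of_equivariant [I.Boundaryless] [FiniteDimensional ℝ E] [IsManifold I ∞ M]
    {θ : ∀ u : M, TangentSpace I u →L[ℝ] F} (hθ : IsSmoothForm I θ)
    {act : M × K → M} (hact : ContMDiff (I.prod IK) I ∞ act)
    {ρ : K → F → F}
    (hequiv : ∀ (v : M) (k : K) (ξ : TangentSpace I v),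
      θ (act (v, k)) (mfderiv I I (fun x => act (x, k)) v ξ) = ρ k (θ v ξ))
    {γ : ℝ → K} (hγ : ContMDiffAt 𝓘(ℝ, ℝ) IK ∞ γ 0) {lam : F}
    (hfund : ∀ v : M, θ (act (v, γ 0)) (mfderiv IK I (fun k => act (v, k)) (γ 0)
      (mfderiv 𝓘(ℝ, ℝ) IK γ 0 (1 : ℝ))) = lam)
    (u : M) (ξ : TangentSpace I u) :
    HasDerivAt (fun s => ρ (γ s) (θ u ξ))
      (mextDeriv I θ (act (u, γ 0))
        (mfderiv IK I (fun k => act (u, k)) (γ 0) (mfderiv 𝓘(ℝ, ℝ) IK γ 0 (1 : ℝ)))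
        (mfderiv I I (fun x => act (x, γ 0)) u ξ)) 0 := by
  obtain ⟨c, hc, rfl, hξ⟩ := exists_curve I u ξ
  let σ : ℝ × ℝ → M := fun p => act (c p.2, γ p.1)
  have hσ : ContMDiffAt 𝓘(ℝ, ℝ × ℝ) I ∞ σ 0 := by
    have h1 : ContMDiffAt 𝓘(ℝ, ℝ × ℝ) I ∞ (fun p : ℝ × ℝ => c p.2) 0 :=
      ContMDiffAt.comp (0 : ℝ × ℝ) (g := c) (f := Prod.snd) hc
        (contDiff_snd.contMDiff.contMDiffAt)
    have h2 : ContMDiffAt 𝓘(ℝ, ℝ × ℝ) IK ∞ (fun p : ℝ × ℝ => γ p.1) 0 :=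
      ContMDiffAt.comp (0 : ℝ × ℝ) (g := γ) (f := Prod.fst) hγ
        (contDiff_fst.contMDiff.contMDiffAt)
    exact hact.contMDiffAt.comp (0 : ℝ × ℝ) (h1.prodMk h2)
  have hσ2 : ContMDiffAt 𝓘(ℝ, ℝ × ℝ) I 2 σ 0 := hσ.of_le ENat.LEInfty.out
  have hactl : ∀ k : K, ∀ x, MDifferentiableAt I I (fun x => act (x, k)) x := fun k x =>
    ((hact.comp (contMDiff_id.prodMk contMDiff_const)).contMDiffAt).mdifferentiableAt (by simp)
  have hactr : ∀ x : M, ∀ k, MDifferentiableAt IK I (fun k => act (x, k)) k := fun x k =>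
    ((hact.comp (contMDiff_const.prodMk contMDiff_id)).contMDiffAt).mdifferentiableAt (by simp)
  -- the partial derivatives of `σ` are the derivatives along the coordinate lines
  have hpart : ∀ p : ℝ × ℝ, MDifferentiableAt 𝓘(ℝ, ℝ × ℝ) I σ p →
      (mfderiv 𝓘(ℝ, ℝ × ℝ) I σ p ((0, 1) : ℝ × ℝ) : E) =
        mfderiv 𝓘(ℝ, ℝ) I (fun t => σ (p.1, t)) p.2 (1 : ℝ) ∧
      (mfderiv 𝓘(ℝ, ℝ × ℝ) I σ p ((1, 0) : ℝ × ℝ) : E) =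
        mfderiv 𝓘(ℝ, ℝ) I (fun s => σ (s, p.2)) p.1 (1 : ℝ) := by
    intro p hp
    constructor
    · have hl : HasFDerivAt (fun t : ℝ => (p.1, t)) (ContinuousLinearMap.inr ℝ ℝ ℝ) p.2 :=
        hasFDerivAt_prodMk_right p.1 p.2
      have := HasMFDerivAt.comp p.2 (g := σ) (f := fun t : ℝ => (p.1, t)) hp.hasMFDerivAt
        hl.hasMFDerivAt
      have e := this.mfderiv
      change _ = (mfderiv 𝓘(ℝ, ℝ) I (σ ∘ fun t => (p.1, t)) p.2) (1 : ℝ)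
      rw [e]
      rfl
    · have hl : HasFDerivAt (fun s : ℝ => (s, p.2)) (ContinuousLinearMap.inl ℝ ℝ ℝ) p.1 :=
        hasFDerivAt_prodMk_left p.1 p.2
      have := HasMFDerivAt.comp p.1 (g := σ) (f := fun s : ℝ => (s, p.2)) hp.hasMFDerivAt
        hl.hasMFDerivAt
      have e := this.mfderiv
      change _ = (mfderiv 𝓘(ℝ, ℝ) I (σ ∘ fun s => (s, p.2)) p.1) (1 : ℝ)
      rw [e]
      rfl
  have hmdiff : ∀ᶠ p in 𝓝 (0 : ℝ × ℝ), MDifferentiableAt 𝓘(ℝ, ℝ × ℝ) I σ p := by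
    filter_upwards [(contMDiffAt_iff_contMDiffAt_nhds (by simp)).1 hσ2] with p hp
    exact hp.mdifferentiableAt (by simp)
  have hline : ∀ d : ℝ × ℝ, Tendsto (fun t : ℝ => t • d) (𝓝 0) (𝓝 0) := by
    intro d
    have : ContinuousAt (fun t : ℝ => t • d) 0 := by fun_prop
    simpa [ContinuousAt] using this
  have hs : ∀ s : ℝ, (mfderiv 𝓘(ℝ, ℝ) I (fun t => σ (s, t)) 0 (1 : ℝ) : E) =
      mfderiv I I (fun x => act (x, γ s)) (c 0) ξ := by
    intro s
    have := mfderiv_comp (0 : ℝ) (hactl (γ s) (c 0)) (hc.mdifferentiableAt (by simp))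
    change (mfderiv 𝓘(ℝ, ℝ) I ((fun x => act (x, γ s)) ∘ c) 0) (1 : ℝ) = _
    rw [this]
    exact congrArg (mfderiv I I (fun x => act (x, γ s)) (c 0) : E → E) hξ
  have ht : ∀ t : ℝ, (mfderiv 𝓘(ℝ, ℝ) I (fun s => σ (s, t)) 0 (1 : ℝ) : E) =
      mfderiv IK I (fun k => act (c t, k)) (γ 0) (mfderiv 𝓘(ℝ, ℝ) IK γ 0 (1 : ℝ)) := by
    intro t
    have := mfderiv_comp (0 : ℝ) (hactr (c t) (γ 0)) (hγ.mdifferentiableAt (by simp))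
    change (mfderiv 𝓘(ℝ, ℝ) I ((fun k => act (c t, k)) ∘ γ) 0) (1 : ℝ) = _
    rw [this]
    rfl
  obtain ⟨a, b, ha, hb, hab⟩ := exists_hasDerivAt_mextDeriv hθ hσ2 ((1, 0) : ℝ × ℝ) (0, 1)
  have hb0 : b = 0 := by
    refine hb.unique ((hasDerivAt_const (0 : ℝ) lam).congr_of_eventuallyEq ?_)
    filter_upwards [(hline (0, 1)).eventually hmdiff] with t hmt
    have hp : t • ((0, 1) : ℝ × ℝ) = (0, t) := by simp
    rw [hp] at hmt ⊢
    rw [← hfund (c t), ← ht t, ← (hpart _ hmt).2]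
  have ha' : HasDerivAt (fun s => ρ (γ s) (θ (c 0) ξ)) a 0 := by
    refine ha.congr_of_eventuallyEq ?_
    filter_upwards [(hline (1, 0)).eventually hmdiff] with s hms
    have hp : s • ((1, 0) : ℝ × ℝ) = (s, 0) := by simp
    rw [hp] at hms ⊢
    rw [← hequiv (c 0), ← hs s, ← (hpart _ hms).1]
  have h0 := hpart 0 hmdiff.self_of_nhds
  convert ha' using 1
  rw [hb0, sub_zero] at hab
  rw [← hab]
  refine (congrArg₂ (fun x y : E => mextDeriv I θ (σ 0) x y) ?_ ?_).symm
  · rw [h0.2]; exact ht 0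
  · rw [h0.1]; exact hs 0

end Forms

/-! ### The Maurer–Cartan form and homomorphisms of Lie groups -/

section LieGroup

open Set Filter Bundle

variable {E H : Type*} [NormedAddCommGroup E] [NormedSpace ℝ E] [TopologicalSpace H]
  {I : ModelWithCorners ℝ E H} {G : Type*} [TopologicalSpace G] [ChartedSpace H G] [Group G]
  {E' H' : Type*} [NormedAddCommGroup E'] [NormedSpace ℝ E'] [TopologicalSpace H']
  {I' : ModelWithCorners ℝ E' H'} {G' : Type*} [TopologicalSpace G'] [ChartedSpace H' G']
  [Group G']

theorem mextDeriv_congr {M : Type*} [TopologicalSpace M] [ChartedSpace H M]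
    {F : Type*} [NormedAddCommGroup F] [NormedSpace ℝ F]
    (θ : ∀ u : M, TangentSpace I u →L[ℝ] F) {x y : M} (hxy : x = y)
    {v v' w w' : E} (hv : v = v') (hw : w = w') :
    mextDeriv I θ x v w = mextDeriv I θ y v' w' := by
  subst hxy hv hw; rfl

theorem mfderiv_congr_apply {M M' : Type*} [TopologicalSpace M] [ChartedSpace H M]
    [TopologicalSpace M'] [ChartedSpace H' M'] {f g : M → M'} (hfg : f = g) {x y : M} (hxy : x = y)
    {v w : E} (hvw : v = w) : (mfderiv I I' f x v : E') = mfderiv I I' g y w := by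
  subst hfg hxy hvw; rfl

variable (I) in
/-- The left Maurer–Cartan form, with values in the tangent space at the identity. -/
noncomputable def maurerCartan (g : G) : TangentSpace I g →L[ℝ] E :=
  mfderiv I I (fun x : G => g⁻¹ * x) g

theorem maurerCartan_one (v : TangentSpace I (1 : G)) : maurerCartan I (1 : G) v = v := by
  have h : (fun x : G => (1 : G)⁻¹ * x) = id := by funext x; simp
  have : (mfderiv I I (fun x : G => (1 : G)⁻¹ * x) 1 v : E) = mfderiv I I id (1 : G) v :=
    mfderiv_congr_apply h rfl rfl
  rw [maurerCartan]
  refine this.trans ?_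
  rw [mfderiv_id]
  rfl

section Comp

variable {E'' H'' : Type*} [NormedAddCommGroup E''] [NormedSpace ℝ E''] [TopologicalSpace H'']
  {I'' : ModelWithCorners ℝ E'' H''} {M M' M'' : Type*}
  [TopologicalSpace M] [ChartedSpace H M] [TopologicalSpace M'] [ChartedSpace H' M']
  [TopologicalSpace M''] [ChartedSpace H'' M'']

theorem mfderiv_comp_apply_of_eq {g : M' → M''} {f : M → M'} {h : M → M''} {x : M} {y : M'}
    (hg : MDifferentiableAt I' I'' g y) (hf : MDifferentiableAt I I' f x) (hy : f x = y)
    (hh : ∀ z, h z = g (f z)) (v : E) :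
    (mfderiv I I'' h x v : E'') = mfderiv I' I'' g y (mfderiv I I' f x v : E') := by
  obtain rfl : h = g ∘ f := funext hh
  subst hy
  rw [mfderiv_comp x hg hf]
  rfl

end Comp

theorem Ad_eq_lieMap (g : G) : Ad I g = lieMap I I (MulAut.conj g).toMonoidHom := rfl

variable [LieGroup I ∞ G] [LieGroup I' ∞ G']

theorem mdifferentiableAt_mul_left (g x : G) : MDifferentiableAt I I (fun y : G => g * y) x :=
  (contMDiff_mul_left (I := I) (n := ∞) (a := g)).contMDiffAt.mdifferentiableAt (by simp)

theorem mdifferentiableAt_mul_right (g x : G) : MDifferentiableAt I I (fun y : G => y * g) x :=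
  (contMDiff_mul_right (I := I) (n := ∞) (a := g)).contMDiffAt.mdifferentiableAt (by simp)

theorem mdifferentiableAt_conj (g x : G) : MDifferentiableAt I I (fun y : G => g * y * g⁻¹) x :=
  (mdifferentiableAt_mul_right g⁻¹ (g * x)).comp x (mdifferentiableAt_mul_left g x)

theorem maurerCartan_mul_left (g k : G) (A : TangentSpace I k) :
    maurerCartan I (g * k) (mfderiv I I (fun x => g * x) k A) = maurerCartan I k A :=
  (mfderiv_comp_apply_of_eq (I := I) (I' := I) (I'' := I) (h := fun x : G => k⁻¹ * x)
    (mdifferentiableAt_mul_left (g * k)⁻¹ (g * k)) (mdifferentiableAt_mul_left g k) rfl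
    (fun z => by group) A).symm

theorem maurerCartan_mul_right (g k : G) (v : TangentSpace I g) :
    maurerCartan I (g * k) (mfderiv I I (fun x => x * k) g v) =
      Ad I k⁻¹ (maurerCartan I g v) := by
  have h1 := mfderiv_comp_apply_of_eq (I := I) (I' := I) (I'' := I)
    (h := fun x : G => (g * k)⁻¹ * (x * k)) (mdifferentiableAt_mul_left (g * k)⁻¹ (g * k))
    (mdifferentiableAt_mul_right k g) rfl (fun z => rfl) v
  have h2 := mfderiv_comp_apply_of_eq (I := I) (I' := I) (I'' := I)
    (h := fun x : G => (g * k)⁻¹ * (x * k)) (mdifferentiableAt_conj k⁻¹ (1 : G))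
    (mdifferentiableAt_mul_left g⁻¹ g) (inv_mul_cancel g) (fun z => by group) v
  exact h1.symm.trans h2

theorem maurerCartan_map {f : G →* G'} (hf : ContMDiff I I' ∞ f) (g : G) (v : TangentSpace I g) :
    maurerCartan I' (f g) (mfderiv I I' f g v) = lieMap I I' f (maurerCartan I g v) := by
  have hfd : ∀ x, MDifferentiableAt I I' f x := fun x =>
    hf.contMDiffAt.mdifferentiableAt (by simp)
  have h1 := mfderiv_comp_apply_of_eq (I := I) (I' := I') (I'' := I')
    (h := fun x : G => (f g)⁻¹ * f x) (mdifferentiableAt_mul_left (f g)⁻¹ (f g))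
    (hfd g) rfl (fun z => rfl) v
  have h2 := mfderiv_comp_apply_of_eq (I := I) (I' := I) (I'' := I')
    (h := fun x : G => (f g)⁻¹ * f x) (hfd 1)
    (mdifferentiableAt_mul_left g⁻¹ g) (inv_mul_cancel g) (fun z => by simp) v
  exact h1.symm.trans h2

/-- The Maurer–Cartan form is smooth: `ω(v) = T(μ)(0, v)` at `(g⁻¹, g)`, where `μ` is the
multiplication of `G`, and the tangent map of `μ` is smooth. -/
theorem isSmoothForm_maurerCartan : IsSmoothForm (F := E) I (maurerCartan I (G := G)) := by
  -- the trivialization of the tangent bundle at `c` is the identity on the tangent space at `c`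
  have hid : ∀ (b c : G) (h : c = b) (v : E),
      (trivializationAt E (TangentSpace I) b (⟨c, v⟩ : TangentBundle I G)).2 = v := by
    rintro b c rfl v
    have := TangentBundle.continuousLinearMapAt_trivializationAt (I := I) (mem_chart_source H c)
    rw [mfderiv_extChartAt_self] at this
    have h2 := DFunLike.congr_fun this v
    exact (congrFun (Trivialization.coe_linearMapAt_of_mem (R := ℝ)
      (trivializationAt E (TangentSpace I) c)
      (mem_baseSet_trivializationAt E (TangentSpace I) c)) v).symm.trans h2
  let F₁ : TangentBundle I G → TangentBundle I G × TangentBundle I G :=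
    fun v => (TotalSpace.mk' E v.proj⁻¹ 0, v)
  have S₁ : ContMDiff I.tangent (I.tangent.prod I.tangent) ∞ F₁ := by
    refine ContMDiff.prodMk ?_ contMDiff_id
    exact (contMDiff_zeroSection ℝ (TangentSpace I)).comp
      ((contMDiff_inv I ∞).comp (contMDiff_proj _))
  let F₃ : TangentBundle (I.prod I) (G × G) → TangentBundle I G :=
    tangentMap (I.prod I) I (fun p : G × G => p.1 * p.2)
  have S₃ : ContMDiff (I.prod I).tangent I.tangent ∞ F₃ :=
    (contMDiff_mul I ∞).contMDiff_tangentMap (m := ∞) le_rfl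
  have S := (S₃.comp (contMDiff_equivTangentBundleProd_symm (I := I) (M := G) (I' := I) (M' := G)
    (n := ∞))).comp S₁
  have hb : ∀ w : TangentBundle I G, F₃ ((equivTangentBundleProd I G I G).symm (F₁ w)) =
      ⟨w.proj⁻¹ * w.proj, maurerCartan I w.proj w.snd⟩ := by
    intro w
    have h := mfderiv_prod_eq_add_apply (I := I) (I' := I) (I'' := I)
      (p := (w.proj⁻¹, w.proj)) (v := ((0 : E), w.snd))
      ((contMDiff_mul (G := G) I ∞).mdifferentiableAt (by simp))
    have hz : (mfderiv I I (fun z : G => z * w.proj) w.proj⁻¹ (0 : TangentSpace I w.proj⁻¹) : E) =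
        0 := map_zero _
    have h' := h.trans ((congrArg (fun x : E => x + maurerCartan I w.proj w.snd) hz).trans
      (zero_add (maurerCartan I w.proj w.snd)))
    exact congrArg (fun x : E => (⟨w.proj⁻¹ * w.proj, x⟩ : TangentBundle I G)) h'
  intro v
  have hv := (contMDiffAt_totalSpace.1 (S v)).2
  refine hv.congr_of_eventuallyEq (Eventually.of_forall fun w => ?_)
  simp only [Function.comp_apply, hb]
  exact (hid _ _ (by simp) _).symm

theorem maurerCartan_mulInvariantVectorField (A : GroupLieAlgebra I G) (g : G) :
    maurerCartan I g (mulInvariantVectorField A g) = A := by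
  have h := maurerCartan_mul_left g (1 : G) A
  rw [maurerCartan_one] at h
  refine Eq.trans ?_ h
  exact congrArg (fun f : E →L[ℝ] E => f (mfderiv I I (fun x : G => g * x) 1 A))
    (form_congr (maurerCartan I) (mul_one g).symm)

variable [FiniteDimensional ℝ E] [I.Boundaryless]

/-- The Maurer–Cartan equation at the identity: the Lie bracket is that of left-invariant vector
fields, on which the form is constant, and this determines the derivatives of the form in a
chart. -/
theorem mextDeriv_maurerCartan [CompleteSpace E] (A B : GroupLieAlgebra I G) :
    mextDeriv (F := E) I (maurerCartan I) (1 : G) A B = -(⁅A, B⁆ : GroupLieAlgebra I G) := by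
  set x₀ := extChartAt I (1 : G) 1 with hx₀
  set α := chartForm (F := E) I (maurerCartan I) (1 : G) with hα
  have hd : DifferentiableAt ℝ α x₀ := differentiableAt_chartForm isSmoothForm_maurerCartan 1
  have hψ : mfderiv 𝓘(ℝ, E) I (extChartAt I (1 : G)).symm x₀ = ContinuousLinearMap.id ℝ _ := by
    have h := mfderivWithin_range_extChartAt_symm (I := I) (x := (1 : G))
    rwa [I.range_eq_univ, mfderivWithin_univ] at h
  have hα0 : ∀ v : E, α x₀ v = v := by
    intro v
    have e := form_congr (F := E) (maurerCartan I (G := G))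
      ((extChartAt I (1 : G)).left_inv (mem_extChartAt_source (I := I) (1 : G)))
    have e2 : (mfderiv 𝓘(ℝ, E) I (extChartAt I (1 : G)).symm x₀ v : E) = v := by
      rw [hψ]; rfl
    change (maurerCartan I ((extChartAt I (1 : G)).symm x₀) : E →L[ℝ] E)
      (mfderiv 𝓘(ℝ, E) I (extChartAt I (1 : G)).symm x₀ v : E) = v
    rw [e2, e]
    exact maurerCartan_one v
  -- the left-invariant vector field of `C` in the chart; the form has the constant value `C` on it
  let X : GroupLieAlgebra I G → E → E := fun C =>
    VectorField.mpullbackWithin 𝓘(ℝ, E) I (extChartAt I (1 : G)).symm (mulInvariantVectorField C)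
      (range I)
  have hXd : ∀ C, DifferentiableAt ℝ (X C) x₀ := by
    intro C
    have h := MDifferentiableWithinAt.differentiableWithinAt_mpullbackWithin_vectorField
      (s := univ) (mdifferentiableAt_mulInvariantVectorField (I := I) C
        (g := (1 : G))).mdifferentiableWithinAt
    rw [preimage_univ, univ_inter, I.range_eq_univ] at h
    have hX : X C = VectorField.mpullbackWithin 𝓘(ℝ, E) I (extChartAt I (1 : G)).symm
        (mulInvariantVectorField C) univ := by
      simp only [X, I.range_eq_univ]; rfl
    rw [hX]
    exact differentiableWithinAt_univ.1 h
  have hconst : ∀ C, ∀ᶠ x in 𝓝 x₀, α x (X C x) = C := by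
    intro C
    filter_upwards [(isOpen_extChartAt_target (I := I) (1 : G)).mem_nhds
      (mem_extChartAt_target (I := I) (1 : G))] with x hx
    have hinv := isInvertible_mfderivWithin_extChartAt_symm hx
    have h1 : (mfderivWithin 𝓘(ℝ, E) I (extChartAt I (1 : G)).symm (range I) x (X C x)) =
        mulInvariantVectorField C ((extChartAt I (1 : G)).symm x) :=
      hinv.self_apply_inverse _
    rw [I.range_eq_univ, mfderivWithin_univ] at h1
    refine Eq.trans ?_ (maurerCartan_mulInvariantVectorField C ((extChartAt I (1 : G)).symm x))
    exact congrArg (maurerCartan I ((extChartAt I (1 : G)).symm x)) h1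
  have hX0 : ∀ C, X C x₀ = C := fun C => by
    rw [← hα0 (X C x₀)]; exact (hconst C).self_of_nhds
  have hderiv : ∀ (C : GroupLieAlgebra I G) (w : E),
      fderiv ℝ (X C) x₀ w = -(fderiv ℝ α x₀ w (C : E)) := by
    intro C w
    have h1 : fderiv ℝ (fun x => α x (X C x)) x₀ = 0 := by
      have : (fun x => α x (X C x)) =ᶠ[𝓝 x₀] fun _ => (C : E) := hconst C
      exact this.fderiv_eq.trans (hasFDerivAt_const (F := E) C x₀).fderiv
    rw [fderiv_clm_apply hd (hXd C)] at h1
    have h2 := DFunLike.congr_fun h1 w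
    have h3 : α x₀ (fderiv ℝ (X C) x₀ w) + fderiv ℝ α x₀ w (X C x₀) = 0 := h2
    rw [hα0, hX0] at h3
    exact eq_neg_of_add_eq_zero_left h3
  have hbr : (⁅A, B⁆ : GroupLieAlgebra I G) =
      fderiv ℝ (X B) x₀ (X A x₀) - fderiv ℝ (X A) x₀ (X B x₀) := by
    have hinv : ∀ f : E →L[ℝ] E, f = ContinuousLinearMap.id ℝ E → ∀ w, f.inverse w = w := by
      rintro _ rfl w
      rw [ContinuousLinearMap.inverse_id]
      rfl
    have hid : (mfderiv I 𝓘(ℝ, E) (extChartAt I (1 : G)) 1 : E →L[ℝ] E) =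
        ContinuousLinearMap.id ℝ E := mfderiv_extChartAt_self
    have h1 : VectorField.lieBracketWithin ℝ (X A) (X B) (range I) x₀ =
        fderiv ℝ (X B) x₀ (X A x₀) - fderiv ℝ (X A) x₀ (X B x₀) := by
      rw [VectorField.lieBracketWithin, I.range_eq_univ, fderivWithin_univ, fderivWithin_univ]
    rw [GroupLieAlgebra.bracket_def, ← VectorField.mlieBracketWithin_univ,
      VectorField.mlieBracketWithin_apply, preimage_univ, univ_inter, ← h1]
    exact hinv _ hid _
  have hmain := mextDeriv_eq (F := E) (θ := maurerCartan I (G := G)) hd A B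
  rw [mfderiv_extChartAt_self] at hmain
  rw [hmain, hbr, hderiv, hderiv, hX0, hX0]
  change fderiv ℝ α x₀ A B - fderiv ℝ α x₀ B A = -(-(fderiv ℝ α x₀ A B) - -(fderiv ℝ α x₀ B A))
  abel

/-- The derivative of the adjoint action is the Lie bracket. This is `hasDerivAt_of_equivariant` for
the Maurer–Cartan form and the right multiplication of `G` on itself. -/
theorem hasDerivAt_Ad_inv [CompleteSpace E] {γ : ℝ → G} (hγ : ContMDiffAt 𝓘(ℝ, ℝ) I ∞ γ 0)
    (h0 : γ 0 = 1) {A : GroupLieAlgebra I G} (hA : (mfderiv 𝓘(ℝ, ℝ) I γ 0 (1 : ℝ) : E) = A)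
    (X : GroupLieAlgebra I G) :
    HasDerivAt (F := E) (fun s => Ad I (γ s)⁻¹ X) (-⁅A, X⁆ : GroupLieAlgebra I G) 0 := by
  have hfund : ∀ v k : G, k = 1 → ∀ a : E, a = A →
      maurerCartan I (v * k) (mfderiv I I (fun x => v * x) k a) = A := by
    rintro v _ rfl a ha
    rw [ha]
    exact (maurerCartan_mul_left v 1 A).trans (maurerCartan_one A)
  have h := hasDerivAt_of_equivariant (F := E) (IK := I) (K := G) (I := I) (M := G)
    isSmoothForm_maurerCartan (act := fun x => x.1 * x.2) (contMDiff_mul I ∞)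
    (ρ := fun k x => Ad I k⁻¹ x) (fun v k ξ => maurerCartan_mul_right v k ξ) hγ
    (lam := A) (fun v => hfund v _ h0 _ hA) 1 X
  have hone : ∀ k : G, k = 1 → ∀ a : E, a = A →
      mextDeriv (F := E) I (maurerCartan I) ((1 : G) * k) (mfderiv I I (fun x : G => 1 * x) k a)
        (mfderiv I I (fun x : G => x * k) 1 X) = (-⁅A, X⁆ : GroupLieAlgebra I G) := by
    rintro _ rfl a ha
    rw [ha]
    refine Eq.trans ?_ (mextDeriv_maurerCartan A X)
    have e1 : (mfderiv I I (fun x : G => 1 * x) 1 A : E) = A := by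
      have : (fun x : G => 1 * x) = id := by funext x; simp
      refine (mfderiv_congr_apply this rfl rfl).trans ?_
      rw [mfderiv_id]; rfl
    have e2 : (mfderiv I I (fun x : G => x * 1) 1 X : E) = X := by
      have : (fun x : G => x * 1) = id := by funext x; simp
      refine (mfderiv_congr_apply this rfl rfl).trans ?_
      rw [mfderiv_id]; rfl
    exact mextDeriv_congr _ (mul_one 1) e1 e2
  have hX : maurerCartan I (1 : G) X = X := maurerCartan_one X
  have h' := hone _ h0 _ hA
  have h2 : HasDerivAt (F := E) (fun s => Ad I (γ s)⁻¹ (maurerCartan I (1 : G) X))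
    (-⁅A, X⁆ : GroupLieAlgebra I G) 0 := h.congr_deriv h'
  exact h2.congr_of_eventuallyEq
    (Eventually.of_forall fun s => congrArg (Ad I (γ s)⁻¹ : E → E) hX.symm)

variable [FiniteDimensional ℝ E'] [I'.Boundaryless]

/-- The derivative of a homomorphism of Lie groups is a homomorphism of Lie algebras, because the
homomorphism pulls back one Maurer–Cartan form to the other. -/
theorem lieMap_lie [CompleteSpace E] [CompleteSpace E'] {f : G →* G'} (hf : ContMDiff I I' ∞ f)
    (A B : GroupLieAlgebra I G) : lieMap I I' f ⁅A, B⁆ = ⁅lieMap I I' f A, lieMap I I' f B⁆ := by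
  have h := mextDeriv_of_pullback (F := E) (F' := E') isSmoothForm_maurerCartan
    isSmoothForm_maurerCartan hf (lieMap I I' f) (maurerCartan_map hf) 1 A B
  have h1 : mextDeriv (F := E') I' (maurerCartan I') (f 1) (mfderiv I I' f 1 A)
      (mfderiv I I' f 1 B) =
      mextDeriv (F := E') I' (maurerCartan I') (1 : G') (lieMap I I' f A) (lieMap I I' f B) :=
    mextDeriv_congr _ (map_one f) rfl rfl
  have h2 := h1.symm.trans h
  rw [mextDeriv_maurerCartan, mextDeriv_maurerCartan] at h2
  have h3 : lieMap I I' f (-⁅A, B⁆) = -lieMap I I' f ⁅A, B⁆ := map_neg _ _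
  exact (neg_injective (h2.trans h3)).symm

theorem Ad_lie [CompleteSpace E] (g : G) (A B : GroupLieAlgebra I G) :
    Ad I g ⁅A, B⁆ = ⁅Ad I g A, Ad I g B⁆ := by
  rw [Ad_eq_lieMap]
  refine lieMap_lie ?_ A B
  exact contMDiff_mul_right.comp contMDiff_mul_left

end LieGroup

/-! ### The curvature of a Cartan connection -/

section Cartan

open Set Filter

variable {E H : Type*} [NormedAddCommGroup E] [NormedSpace ℝ E] [TopologicalSpace H]
  {I : ModelWithCorners ℝ E H} {G : Type*} [TopologicalSpace G] [ChartedSpace H G] [Group G]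
  {EP HP : Type*} [NormedAddCommGroup EP] [NormedSpace ℝ EP] [TopologicalSpace HP]
  {IP : ModelWithCorners ℝ EP HP} {P : Subgroup G} [ChartedSpace HP P]
  {EB HB : Type*} [NormedAddCommGroup EB] [NormedSpace ℝ EB] [TopologicalSpace HB]
  {IB : ModelWithCorners ℝ EB HB} {B : Type*} [TopologicalSpace B] [ChartedSpace HB B]
  [CompleteSpace E] [LieGroup I ∞ G]
  [FiniteDimensional ℝ EB] [IB.Boundaryless] [IsManifold IB ∞ B]

theorem curvature_swap {θ : ∀ u : B, TangentSpace IB u →L[ℝ] GroupLieAlgebra I G}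
    (hθ : IsSmoothForm (F := E) IB θ) (u : B) (ξ η : TangentSpace IB u) :
    curvature I IB θ u ξ η = -curvature I IB θ u η ξ := by
  have hd := differentiableAt_chartForm (F := E) hθ u
  have h : lieExtDeriv I IB θ u ξ η = -lieExtDeriv I IB θ u η ξ := by
    rw [lieExtDeriv, lieExtDeriv, mextDeriv_eq (F := E) hd, mextDeriv_eq (F := E) hd]
    exact (neg_sub (α := E) _ _).symm
  rw [curvature, curvature, h, ← lie_skew, neg_add]

theorem curvature_add_left {θ : ∀ u : B, TangentSpace IB u →L[ℝ] GroupLieAlgebra I G}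
    (hθ : IsSmoothForm (F := E) IB θ) (u : B) (ξ ξ' η : TangentSpace IB u) :
    curvature I IB θ u (ξ + ξ') η = curvature I IB θ u ξ η + curvature I IB θ u ξ' η := by
  have hd := differentiableAt_chartForm (F := E) hθ u
  have h : lieExtDeriv I IB θ u (ξ + ξ') η =
      lieExtDeriv I IB θ u ξ η + lieExtDeriv I IB θ u ξ' η := by
    rw [lieExtDeriv, lieExtDeriv, lieExtDeriv, mextDeriv_eq (F := E) hd, mextDeriv_eq (F := E) hd,
      mextDeriv_eq (F := E) hd, map_add]
    have key : ∀ (α : EB →L[ℝ] EB →L[ℝ] E) (a a' b : EB),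
        α (a + a') b - α b (a + a') = (α a b - α b a) + (α a' b - α b a') := by
      intro α a a' b
      rw [map_add, map_add, add_apply]
      abel
    exact key _ _ _ _
  rw [curvature, curvature, curvature, h, map_add, add_lie]
  abel

theorem curvature_smul_left {θ : ∀ u : B, TangentSpace IB u →L[ℝ] GroupLieAlgebra I G}
    (hθ : IsSmoothForm (F := E) IB θ) (u : B) (c : ℝ) (ξ η : TangentSpace IB u) :
    curvature I IB θ u (c • ξ) η = c • curvature I IB θ u ξ η := by
  have hd := differentiableAt_chartForm (F := E) hθ u
  have h : lieExtDeriv I IB θ u (c • ξ) η = c • lieExtDeriv I IB θ u ξ η := by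
    rw [lieExtDeriv, lieExtDeriv, mextDeriv_eq (F := E) hd, mextDeriv_eq (F := E) hd, map_smul]
    have key : ∀ (α : EB →L[ℝ] EB →L[ℝ] E) (a b : EB),
        α (c • a) b - α b (c • a) = c • (α a b - α b a) := by
      intro α a b
      rw [map_smul, map_smul, smul_apply, smul_sub]
    exact key _ _ _
  rw [curvature, curvature, h, map_smul, smul_lie, smul_add]

theorem exists_curvatureFunction_linear {θ : ∀ u : B, TangentSpace IB u →L[ℝ] GroupLieAlgebra I G}
    (hθ : IsSmoothForm (F := E) IB θ) (u : B) :
    ∃ κ : GroupLieAlgebra I G →ₗ[ℝ] GroupLieAlgebra I G →ₗ[ℝ] GroupLieAlgebra I G,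
      ∀ X Y, κ X Y = curvatureFunction I IB θ u X Y := by
  have hadd : ∀ X X' Y, curvatureFunction I IB θ u (X + X') Y =
      curvatureFunction I IB θ u X Y + curvatureFunction I IB θ u X' Y := fun X X' Y => by
    simp only [curvatureFunction, map_add, curvature_add_left hθ]
  have hsmul : ∀ (c : ℝ) X Y, curvatureFunction I IB θ u (c • X) Y =
      c • curvatureFunction I IB θ u X Y := fun c X Y => by
    simp only [curvatureFunction, map_smul, curvature_smul_left hθ]
  have hswap : ∀ X Y, curvatureFunction I IB θ u X Y = -curvatureFunction I IB θ u Y X :=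
    fun X Y => curvature_swap hθ u _ _
  refine ⟨LinearMap.mk₂ ℝ (curvatureFunction I IB θ u) hadd hsmul (fun X Y Y' => ?_)
    (fun c X Y => ?_), fun X Y => rfl⟩
  · rw [hswap, hadd, neg_add, ← hswap, ← hswap]
  · rw [hswap, hsmul, ← smul_neg, ← hswap]

variable [MulAction (P)ᵐᵒᵖ B] [FiniteDimensional ℝ E] [I.Boundaryless] [IP.Boundaryless]
  [LieGroup IP ∞ P]

/-- The curvature of a Cartan connection is horizontal: the Cartan connection is constant on the
generators of the principal action and equivariant, so that its exterior derivative on a generator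
is given by the derivative of the adjoint action, i.e. by a Lie bracket. -/
theorem curvature_eq_zero_of_mem {θ : ∀ u : B, TangentSpace IB u →L[ℝ] GroupLieAlgebra I G}
    (hθ : IsCartanConnection I IP (P := P) IB θ)
    (hact : ContMDiff (IB.prod IP) IB ∞ (fun x : B × P => MulOpposite.op x.2 • x.1))
    (hsub : ContMDiff IP I ∞ (Subtype.val : P → G)) (u : B) (ξ η : TangentSpace IB u)
    (hξ : θ u ξ ∈ subgroupLieAlgebra I IP P) : curvature I IB θ u ξ η = 0 := by
  obtain ⟨A, hA⟩ := hξ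
  replace hA : lieMap IP I P.subtype A = θ u ξ := hA
  obtain ⟨γ, hγ, h0, h1⟩ := exists_curve IP (1 : P) (A : EP)
  have hfund : ∀ (v : B) (p : P), p = 1 → ∀ a : EP, a = A →
      θ (MulOpposite.op p • v) (mfderiv IP IB (fun p : P => MulOpposite.op p • v) p a) =
        lieMap IP I P.subtype A := by
    rintro v _ rfl a ha
    rw [ha]
    exact hθ.fundamental v A
  have h2 := hasDerivAt_of_equivariant (F := E) (θ := θ) hθ.smooth hact
    (ρ := fun p x => Ad I (p : G)⁻¹ x) (fun v p ζ => hθ.equivariant v p ζ) hγ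
    (lam := lieMap IP I P.subtype A) (fun v => hfund v _ h0 _ h1) u η
  have hγ' : ContMDiffAt 𝓘(ℝ, ℝ) I ∞ (fun t => (γ t : G)) 0 := hsub.contMDiffAt.comp (0 : ℝ) hγ
  have hvel : (mfderiv 𝓘(ℝ, ℝ) I (fun t => (γ t : G)) 0 (1 : ℝ) : E) =
      lieMap IP I P.subtype A := by
    have := mfderiv_comp_apply_of_eq (I := 𝓘(ℝ, ℝ)) (I' := IP) (I'' := I)
      (h := fun t => (γ t : G)) (g := (Subtype.val : P → G)) (f := γ) (x := (0 : ℝ)) (y := 1)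
      (hsub.contMDiffAt.mdifferentiableAt (by simp)) (hγ.mdifferentiableAt (by simp)) h0
      (fun z => rfl) 1
    rw [this, h1]
    rfl
  have h3 := hasDerivAt_Ad_inv hγ' (by simp [h0]) hvel (θ u η)
  have h4 := h2.unique h3
  have h5 : ∀ p : P, p = 1 → ∀ a : EP, a = A →
      mextDeriv (F := E) IB θ (MulOpposite.op p • u)
        (mfderiv IP IB (fun p : P => MulOpposite.op p • u) p a)
        (mfderiv IB IB (fun v : B => MulOpposite.op p • v) u η) =
      mextDeriv (F := E) IB θ u ξ η := by
    rintro _ rfl a ha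
    rw [ha]
    have hone : MulOpposite.op (1 : P) • u = u := one_smul (P)ᵐᵒᵖ u
    have e1 : (mfderiv IP IB (fun p : P => MulOpposite.op p • u) 1 A : EB) = ξ := by
      apply (hθ.isInvertible u).injective
      refine Eq.trans ?_ ((hθ.fundamental u A).trans hA)
      exact congrArg (fun f : EB →L[ℝ] E =>
        f (mfderiv IP IB (fun p : P => MulOpposite.op p • u) 1 A))
        (form_congr (F := E) θ hone.symm)
    have e2 : (mfderiv IB IB (fun v : B => MulOpposite.op (1 : P) • v) u η : EB) = η := by
      have : (fun v : B => MulOpposite.op (1 : P) • v) = id := by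
        funext v; exact one_smul (P)ᵐᵒᵖ v
      refine (mfderiv_congr_apply this rfl rfl).trans ?_
      rw [mfderiv_id]; rfl
    exact mextDeriv_congr (F := E) θ hone e1 e2
  have h6 := (h5 _ h0 _ h1).symm.trans h4
  rw [curvature, ← hA]
  have h7 : lieExtDeriv I IB θ u ξ η = -⁅lieMap IP I P.subtype A, θ u η⁆ := h6
  rw [h7, neg_add_cancel]

end Cartan

/-! ### Submersions -/

section Submersion

open Set Filter

variable {E H : Type*} [NormedAddCommGroup E] [NormedSpace ℝ E] [TopologicalSpace H]
  {I : ModelWithCorners ℝ E H} {M : Type*} [TopologicalSpace M] [ChartedSpace H M]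
  {E' H' : Type*} [NormedAddCommGroup E'] [NormedSpace ℝ E'] [TopologicalSpace H']
  {I' : ModelWithCorners ℝ E' H'} {M' : Type*} [TopologicalSpace M'] [ChartedSpace H' M']
  {E'' H'' : Type*} [NormedAddCommGroup E''] [NormedSpace ℝ E''] [TopologicalSpace H'']
  {I'' : ModelWithCorners ℝ E'' H''} {M'' : Type*} [TopologicalSpace M''] [ChartedSpace H'' M'']

/-- A submersion has a smooth local section through every point. It is the inverse of the submersion
on a slice that is complementary to the kernel of the derivative. -/
theorem IsSmoothSubmersion.exists_local_section [I.Boundaryless] [IsManifold I ∞ M]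
    [I'.Boundaryless] [FiniteDimensional ℝ E'] [IsManifold I' ∞ M'] {f : M → M'}
    (hf : IsSmoothSubmersion I I' f) (x : M) :
    ∃ s : M' → M, ContMDiffAt I' I ∞ s (f x) ∧ s (f x) = x ∧ ∀ᶠ y in 𝓝 (f x), f (s y) = y := by
  obtain ⟨σ, hσ, rfl, hid⟩ := exists_parametrization I x
  -- a linear right inverse `R` of the derivative
  let D : E →L[ℝ] E' := mfderiv I I' f (σ 0)
  obtain ⟨R, hR⟩ := D.toLinearMap.exists_rightInverse_of_surjective
    (LinearMap.range_eq_top.2 (hf.surjective_mfderiv (σ 0)))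
  let R' : E' →L[ℝ] E := LinearMap.toContinuousLinearMap R
  have hDR : ∀ w, D (R' w) = w := fun w => LinearMap.congr_fun hR w
  let g : E' → E' := fun w => extChartAt I' (f (σ 0)) (f (σ (R' w)))
  have hσR : ContMDiffAt 𝓘(ℝ, E') I ∞ (fun w => σ (R' w)) 0 := by
    have : ContMDiffAt 𝓘(ℝ, E) I ∞ σ (R' 0) := by rwa [map_zero]
    exact this.comp (0 : E') R'.contMDiff.contMDiffAt
  have hg : ContDiffAt ℝ ∞ g 0 := by
    rw [← contMDiffAt_iff_contDiffAt]
    have h1 : ContMDiffAt I' 𝓘(ℝ, E') ∞ (extChartAt I' (f (σ 0))) (f (σ (R' 0))) := by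
      rw [map_zero]; exact contMDiffAt_extChartAt
    exact h1.comp (0 : E') (hf.contMDiff.contMDiffAt.comp (0 : E') hσR)
  have hg0 : g 0 = extChartAt I' (f (σ 0)) (f (σ 0)) := by simp only [g, map_zero]
  have hgD : ∀ w, fderiv ℝ g 0 w = w := by
    intro w
    have hR0 : R' 0 = 0 := map_zero R'
    have e1 := mfderiv_comp_apply_of_eq (I := 𝓘(ℝ, E')) (I' := 𝓘(ℝ, E)) (I'' := I)
      (h := fun w => σ (R' w)) (hσ.mdifferentiableAt (by simp))
      (R'.contMDiff.contMDiffAt.mdifferentiableAt (n := ∞) (by simp)) hR0 (fun _ => rfl) w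
    have e2 := mfderiv_comp_apply_of_eq (I := 𝓘(ℝ, E')) (I' := I) (I'' := I')
      (h := fun w => f (σ (R' w))) (hf.contMDiff.contMDiffAt.mdifferentiableAt (by simp))
      (hσR.mdifferentiableAt (by simp)) (congrArg σ hR0) (fun _ => rfl) w
    have e3 := mfderiv_comp_apply_of_eq (I := 𝓘(ℝ, E')) (I' := I') (I'' := 𝓘(ℝ, E'))
      (h := g) (mdifferentiableAt_extChartAt (mem_chart_source H' (f (σ 0))))
      ((hf.contMDiff.contMDiffAt.comp (0 : E') hσR).mdifferentiableAt (by simp))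
      (congrArg (fun x => f (σ x)) hR0) (fun _ => rfl) w
    rw [mfderiv_extChartAt_self] at e3
    rw [← mfderiv_eq_fderiv]
    refine e3.trans (e2.trans ?_)
    rw [e1]
    refine Eq.trans ?_ (hDR w)
    refine congrArg D ?_
    refine (hid _).trans ?_
    rw [mfderiv_eq_fderiv, R'.fderiv]
    rfl
  have hg' : HasFDerivAt g ((ContinuousLinearEquiv.refl ℝ E' : E' ≃L[ℝ] E') : E' →L[ℝ] E') 0 := by
    have h1 := (hg.differentiableAt (by simp)).hasFDerivAt
    have h2 : fderiv ℝ g 0 = ((ContinuousLinearEquiv.refl ℝ E' : E' ≃L[ℝ] E') : E' →L[ℝ] E') :=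
      ContinuousLinearMap.ext hgD
    rwa [h2] at h1
  have : CompleteSpace E' := FiniteDimensional.complete ℝ E'
  let h : E' → E' := hg.localInverse hg' (by simp)
  have hsm : ContDiffAt ℝ ∞ h (g 0) := hg.to_localInverse hg' (by simp)
  have hh0 : h (g 0) = 0 := hg.localInverse_apply_image hg' (by simp)
  have hgh : ∀ᶠ z in 𝓝 (g 0), g (h z) = z :=
    (hg.hasStrictFDerivAt' hg' (by simp)).eventually_right_inverse
  rw [hg0] at hsm hh0 hgh
  let s : M' → M := fun y => σ (R' (h (extChartAt I' (f (σ 0)) y)))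
  have hs0 : s (f (σ 0)) = σ 0 := by simp only [s, hh0, map_zero]
  have hs : ContMDiffAt I' I ∞ s (f (σ 0)) := by
    have h1 : ContMDiffAt I' 𝓘(ℝ, E') ∞ (fun y => h (extChartAt I' (f (σ 0)) y)) (f (σ 0)) :=
      hsm.contMDiffAt.comp (f (σ 0)) contMDiffAt_extChartAt
    have h2 : ContMDiffAt 𝓘(ℝ, E') I ∞ (fun w => σ (R' w))
        (h (extChartAt I' (f (σ 0)) (f (σ 0)))) := by rwa [hh0]
    exact ContMDiffAt.comp (g := fun w => σ (R' w)) (f (σ 0)) h2 h1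
  refine ⟨s, hs, hs0, ?_⟩
  have hfs : ContinuousAt (fun y => f (s y)) (f (σ 0)) :=
    ContinuousAt.comp (g := f) hf.contMDiff.continuous.continuousAt hs.continuousAt
  have hsrc := extChartAt_source_mem_nhds (I := I') (f (σ 0))
  have hsrc' : (extChartAt I' (f (σ 0))).source ∈ 𝓝 (f (s (f (σ 0)))) := by rwa [hs0]
  filter_upwards [hfs.eventually hsrc', hsrc,
    (continuousAt_extChartAt (I := I') (f (σ 0))).eventually hgh] with y hy1 hy2 hy3
  exact (extChartAt I' (f (σ 0))).injOn hy1 hy2 hy3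

/-- A map out of the target of a submersion is smooth if its composition with the submersion is. -/
theorem IsSmoothSubmersion.contMDiffAt_of_comp [I.Boundaryless] [IsManifold I ∞ M]
    [I'.Boundaryless] [FiniteDimensional ℝ E'] [IsManifold I' ∞ M'] {f : M → M'}
    (hf : IsSmoothSubmersion I I' f) {g : M' → M''} {x : M}
    (hg : ContMDiffAt I I'' ∞ (g ∘ f) x) : ContMDiffAt I' I'' ∞ g (f x) := by
  obtain ⟨s, hs, hs0, hfs⟩ := hf.exists_local_section x
  have h1 : ContMDiffAt I I'' ∞ (g ∘ f) (s (f x)) := by rwa [hs0]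
  refine (h1.comp (f x) hs).congr_of_eventuallyEq ?_
  filter_upwards [hfs] with y hy
  rw [Function.comp_apply, Function.comp_apply, hy]

end Submersion

/-! ### Principal bundles -/

section Principal

open Set Filter

variable {G : Type*} [Group G] [TopologicalSpace G]
  {EP HP : Type*} [NormedAddCommGroup EP] [NormedSpace ℝ EP] [TopologicalSpace HP]
  {IP : ModelWithCorners ℝ EP HP} {P : Subgroup G} [ChartedSpace HP P]
  {EB HB : Type*} [NormedAddCommGroup EB] [NormedSpace ℝ EB] [TopologicalSpace HB]
  {IB : ModelWithCorners ℝ EB HB} {B : Type*} [TopologicalSpace B] [ChartedSpace HB B]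
  [MulAction (P)ᵐᵒᵖ B]
  {EM HM : Type*} [NormedAddCommGroup EM] [NormedSpace ℝ EM] [TopologicalSpace HM]
  {IM : ModelWithCorners ℝ EM HM} {M : Type*} [TopologicalSpace M] [ChartedSpace HM M]

theorem IsPrincipalBundle.contMDiff_proj {π : B → M}
    (hπ : IsPrincipalBundle IP (P := P) IB IM π) : ContMDiff IB IM ∞ π := by
  intro u
  obtain ⟨e, he, hsm, -, -⟩ := hπ.locally_trivial (π u)
  have hu : u ∈ e.source := e.mem_source.2 he
  have h1 : ContMDiffAt IB (IM.prod IP) ∞ e u := hsm.contMDiffAt (e.open_source.mem_nhds hu)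
  refine (contMDiffAt_fst.comp u h1).congr_of_eventuallyEq ?_
  filter_upwards [e.open_source.mem_nhds hu] with v hv
  exact (e.coe_fst hv).symm

/-- The kernel of the derivative of the projection of a principal bundle consists of the generators
of the principal action. -/
theorem IsPrincipalBundle.exists_generator [LieGroup IP ∞ P] {π : B → M}
    (hπ : IsPrincipalBundle IP (P := P) IB IM π) (u : B) (ξ : TangentSpace IB u)
    (hξ : mfderiv IB IM π u ξ = 0) :
    ∃ A : EP, (mfderiv IP IB (fun p : P => MulOpposite.op p • u) 1 A : EB) = ξ := by
  obtain ⟨e, he, hsm, hsymm, hequiv⟩ := hπ.locally_trivial (π u)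
  have hu : u ∈ e.source := e.mem_source.2 he
  have hmem : (π u, (e u).2) ∈ e.target := e.mem_target.2 he
  have hπd : MDifferentiableAt IB IM π u :=
    hπ.contMDiff_proj.contMDiffAt.mdifferentiableAt (by simp)
  have hed : MDifferentiableAt IB (IM.prod IP) e u :=
    (hsm.contMDiffAt (e.open_source.mem_nhds hu)).mdifferentiableAt (by simp)
  have hsd : MDifferentiableAt IB IP (fun v => (e v).2) u := mdifferentiableAt_snd.comp u hed
  have hSd : MDifferentiableAt (IM.prod IP) IB e.toOpenPartialHomeomorph.symm (π u, (e u).2) :=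
    (hsymm.contMDiffAt (e.open_target.mem_nhds hmem)).mdifferentiableAt (by simp)
  have hid : (fun v => e.toOpenPartialHomeomorph.symm (π v, (e v).2)) =ᶠ[𝓝 u] id := by
    filter_upwards [e.open_source.mem_nhds hu] with v hv
    rw [← e.coe_fst hv]
    exact e.toOpenPartialHomeomorph.left_inv hv
  have h1 := mfderiv_comp_apply_of_eq (I := IB) (I' := IM.prod IP) (I'' := IB)
    (h := fun v => e.toOpenPartialHomeomorph.symm (π v, (e v).2)) hSd (hπd.prodMk hsd) rfl
    (fun _ => rfl) ξ
  have h2 : (mfderiv IB IB (fun v => e.toOpenPartialHomeomorph.symm (π v, (e v).2)) u ξ : EB) =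
      ξ := by
    rw [hid.mfderiv_eq, mfderiv_id]
    rfl
  have h3 : (mfderiv IB (IM.prod IP) (fun v => (π v, (e v).2)) u ξ : EM × EP) =
      ((0 : EM), (mfderiv IB IP (fun v => (e v).2) u ξ : EP)) := by
    rw [mfderiv_prodMk hπd hsd]
    exact Prod.ext hξ rfl
  have h4 := mfderiv_prod_eq_add_apply
    (v := (((0 : EM), (mfderiv IB IP (fun v => (e v).2) u ξ : EP)) : EM × EP)) hSd
  have h5 : (mfderiv IM IB (fun z : M => e.toOpenPartialHomeomorph.symm (z, (e u).2)) (π u)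
    (0 : TangentSpace IM (π u)) : EB) = 0 := map_zero _
  -- in the direction of the fibre the inverse of the trivialization is the orbit map of `u`
  have horb : ∀ p : P, e.toOpenPartialHomeomorph.symm (π u, p) =
      MulOpposite.op ((e u).2⁻¹ * p) • u := by
    intro p
    have hv : MulOpposite.op ((e u).2⁻¹ * p) • u ∈ e.source :=
      e.mem_source.2 (by rwa [hπ.proj_action])
    have : e (MulOpposite.op ((e u).2⁻¹ * p) • u) = (π u, p) := by
      refine Prod.ext ?_ ?_
      · rw [e.coe_fst hv, hπ.proj_action]
      · rw [hequiv u hu, mul_inv_cancel_left]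
    rw [← this]
    exact e.toOpenPartialHomeomorph.left_inv hv
  have hfun : (fun p : P => e.toOpenPartialHomeomorph.symm (π u, p)) =
      fun p => MulOpposite.op ((e u).2⁻¹ * p) • u := funext horb
  have hact : MDifferentiableAt IP IB (fun p : P => MulOpposite.op p • u) 1 :=
    (hπ.contMDiff_action.comp
      (contMDiff_const.prodMk contMDiff_id)).contMDiffAt.mdifferentiableAt (n := ∞) (by simp)
  have h6 := mfderiv_comp_apply_of_eq (I := IP) (I' := IP) (I'' := IB)
    (h := fun p : P => MulOpposite.op ((e u).2⁻¹ * p) • u) (f := fun p => (e u).2⁻¹ * p)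
    (x := (e u).2) hact (mdifferentiableAt_mul_left (e u).2⁻¹ (e u).2) (inv_mul_cancel _)
    (fun _ => rfl) (mfderiv IB IP (fun v => (e v).2) u ξ)
  refine ⟨_, h6.symm.trans ?_⟩
  refine (mfderiv_congr_apply hfun rfl rfl).symm.trans ?_
  refine Eq.trans ?_ (h1.symm.trans h2)
  rw [h3]
  refine Eq.trans ?_ h4.symm
  exact ((congrArg (fun x : EB => x + _) h5).trans (zero_add _)).symm

end Principal

/-! ### The extended bundle -/

section Fefferman

open Set Filter

namespace ExtendedBundle

variable {G G' : Type*} [Group G] [Group G'] {P : Subgroup G} {P' : Subgroup G'} {i : G →* G'}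
  {hQ : P'.comap i ≤ P} {B : Type*} [MulAction (P)ᵐᵒᵖ B]

theorem op_smul_mk (u : B) (a b : P') :
    MulOpposite.op b • mk hQ (u, a) = mk hQ (u, a * b) := rfl

theorem exists_rep (x : ExtendedBundle hQ B) : ∃ (u : B) (a : P'), mk hQ (u, a) = x := by
  induction x using Quotient.inductionOn with
  | h x => exact ⟨x.1, x.2, rfl⟩

/-- The projection `[u, a] ↦ π(u)` of the extended bundle to the base of the original bundle. -/
def toBase {M : Type*} (π : B → M) (hπ : ∀ (u : B) (p : P), π (MulOpposite.op p • u) = π u) :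
    ExtendedBundle hQ B → M :=
  Quotient.lift (fun x : B × P' => π x.1) (by
    rintro x y ⟨q, hq, h1, -⟩
    exact (hπ _ _).symm.trans (congrArg π h1.symm))

end ExtendedBundle

variable {E H : Type*} [NormedAddCommGroup E] [NormedSpace ℝ E]
  [TopologicalSpace H] {I : ModelWithCorners ℝ E H} {G : Type*} [Group G]
  {EP HP : Type*} [NormedAddCommGroup EP] [NormedSpace ℝ EP]
  [TopologicalSpace HP] {IP : ModelWithCorners ℝ EP HP} {P : Subgroup G}
  {E' H' : Type*} [NormedAddCommGroup E'] [NormedSpace ℝ E']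
  [TopologicalSpace H'] {I' : ModelWithCorners ℝ E' H'} {G' : Type*} [TopologicalSpace G']
  [ChartedSpace H' G'] [Group G'] {EP' HP' : Type*} [NormedAddCommGroup EP'] [NormedSpace ℝ EP']
  [TopologicalSpace HP'] {IP' : ModelWithCorners ℝ EP' HP'} {P' : Subgroup G'}
  [ChartedSpace HP' P'] {i : G →* G'} {hQ : P'.comap i ≤ P}
  {EB HB : Type*} [NormedAddCommGroup EB] [NormedSpace ℝ EB] [TopologicalSpace HB]
  {IB : ModelWithCorners ℝ EB HB} {B : Type*} [TopologicalSpace B] [ChartedSpace HB B]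
  [MulAction (P)ᵐᵒᵖ B]
  {EM HM : Type*} [NormedAddCommGroup EM] [NormedSpace ℝ EM] [TopologicalSpace HM]
  {IM : ModelWithCorners ℝ EM HM} {M : Type*} [TopologicalSpace M] [ChartedSpace HM M]
  {EM' HM' : Type*} [NormedAddCommGroup EM'] [NormedSpace ℝ EM'] [TopologicalSpace HM']
  {IM' : ModelWithCorners ℝ EM' HM'} [ChartedSpace HM' (FeffermanSpace hQ B)]
  {EB' HB' : Type*} [NormedAddCommGroup EB'] [NormedSpace ℝ EB'] [TopologicalSpace HB']
  {IB' : ModelWithCorners ℝ EB' HB'} [ChartedSpace HB' (ExtendedBundle hQ B)]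

theorem mdifferentiableAt_mk
    (hmk : IsSmoothSubmersion (IB.prod IP') IB' (ExtendedBundle.mk hQ (B := B)))
    (x : B × P') : MDifferentiableAt (IB.prod IP') IB' (ExtendedBundle.mk hQ (B := B)) x :=
  hmk.contMDiff.contMDiffAt.mdifferentiableAt (by simp)

theorem mfderiv_mk_apply
    (hmk : IsSmoothSubmersion (IB.prod IP') IB' (ExtendedBundle.mk hQ (B := B)))
    (u : B) (a : P') (ξ : EB) (η : EP') :
    (mfderiv (IB.prod IP') IB' (ExtendedBundle.mk hQ (B := B)) (u, a) ((ξ, η) : EB × EP') : EB') =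
      (mfderiv IB IB' (fun v => ExtendedBundle.mk hQ (v, a)) u ξ : EB') +
        (mfderiv IP' IB' (fun b => ExtendedBundle.mk hQ (u, b)) a η : EB') :=
  mfderiv_prod_eq_add_apply (v := ((ξ, η) : EB × EP')) (mdifferentiableAt_mk hmk (u, a))

variable [IsManifold IB' ∞ (ExtendedBundle hQ B)] [IsManifold IB ∞ B] [LieGroup IP' ∞ P']
  [IB.Boundaryless] [IB'.Boundaryless] [IP'.Boundaryless] [FiniteDimensional ℝ EB']

/-- The principal action on the extended bundle is smooth: along a local section of the submersion
`B × P' → B ×_Q P'` it is given by the multiplication of `P'`. -/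
theorem contMDiff_extendedBundle_action
    (hmk : IsSmoothSubmersion (IB.prod IP') IB' (ExtendedBundle.mk hQ (B := B))) :
    ContMDiff (IB'.prod IP') IB' ∞
      (fun x : ExtendedBundle hQ B × P' => MulOpposite.op x.2 • x.1) := by
  rintro ⟨y, c⟩
  obtain ⟨u, a, rfl⟩ := ExtendedBundle.exists_rep y
  obtain ⟨s, hs, hs0, hsec⟩ := hmk.exists_local_section (u, a)
  have h1 : ContMDiffAt (IB'.prod IP') (IB.prod IP') ∞
      (fun x : ExtendedBundle hQ B × P' => s x.1) (ExtendedBundle.mk hQ (u, a), c) :=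
    ContMDiffAt.comp (g := s) (f := Prod.fst) (ExtendedBundle.mk hQ (u, a), c) hs contMDiffAt_fst
  have h2 : ContMDiffAt (IB'.prod IP') (IB.prod IP') ∞
      (fun x : ExtendedBundle hQ B × P' => ((s x.1).1, (s x.1).2 * x.2))
      (ExtendedBundle.mk hQ (u, a), c) :=
    (contMDiffAt_fst.comp _ h1).prodMk ((contMDiffAt_snd.comp _ h1).mul contMDiffAt_snd)
  refine (hmk.contMDiff.contMDiffAt.comp _ h2).congr_of_eventuallyEq ?_
  filter_upwards [continuousAt_fst.eventually hsec] with x hx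
  conv_lhs => rw [← hx]
  rfl

variable [TopologicalSpace G] [ChartedSpace H G] [ChartedSpace HP P]
  {θ : ∀ u : B, TangentSpace IB u →L[ℝ] GroupLieAlgebra I G}
  {θ' : ∀ u : ExtendedBundle hQ B, TangentSpace IB' u →L[ℝ] GroupLieAlgebra I' G'}

/-- The pullback of the induced connection along `u ↦ [u, a]` is `Ad(a⁻¹) ∘ i' ∘ θ`. -/
theorem IsInducedGeometry.pullback_mk
    (hθ' : IsInducedGeometry I I' IP' hQ IB IM' IB' θ θ') (a : P') (u : B)
    (ξ : TangentSpace IB u) :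
    θ' (ExtendedBundle.mk hQ (u, a)) (mfderiv IB IB' (fun v => ExtendedBundle.mk hQ (v, a)) u ξ) =
      Ad I' (a : G')⁻¹ (lieMap I I' i (θ u ξ)) := by
  have hact := contMDiff_extendedBundle_action hθ'.submersion_bundle
  have hincl : MDifferentiableAt IB IB' (ExtendedBundle.incl hQ (B := B)) u :=
    ((hθ'.submersion_bundle.contMDiff.comp
      (contMDiff_id.prodMk contMDiff_const)).contMDiffAt).mdifferentiableAt (by simp)
  have hop : MDifferentiableAt IB' IB' (fun y : ExtendedBundle hQ B => MulOpposite.op a • y)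
      (ExtendedBundle.incl hQ u) :=
    ((hact.comp (contMDiff_id.prodMk contMDiff_const)).contMDiffAt).mdifferentiableAt (by simp)
  have hmk : ∀ v : B, ExtendedBundle.mk hQ (v, a) =
      MulOpposite.op a • ExtendedBundle.incl hQ v := fun v => by
    rw [ExtendedBundle.incl, ExtendedBundle.op_smul_mk, one_mul]
  have h1 := mfderiv_comp_apply_of_eq (I := IB) (I' := IB') (I'' := IB')
    (h := fun v => ExtendedBundle.mk hQ (v, a)) hop hincl rfl hmk ξ
  rw [← hθ'.pullback, ← hθ'.cartan.equivariant]
  refine Eq.trans ?_ (congrArg (fun f : EB' →L[ℝ] E' => f _) (form_congr (F := E') θ' (hmk u)))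
  exact congrArg (θ' (ExtendedBundle.mk hQ (u, a)) : EB' → E') h1

/-- The induced connection on the fibres of the extended bundle is the Maurer–Cartan form. -/
theorem IsInducedGeometry.apply_fibre
    (hθ' : IsInducedGeometry I I' IP' hQ IB IM' IB' θ θ') (a : P') (u : B)
    (η : TangentSpace IP' a) :
    θ' (ExtendedBundle.mk hQ (u, a)) (mfderiv IP' IB' (fun b => ExtendedBundle.mk hQ (u, b)) a η) =
      lieMap IP' I' P'.subtype (maurerCartan IP' a η) := by
  have hact := contMDiff_extendedBundle_action hθ'.submersion_bundle
  have hop : MDifferentiableAt IP' IB'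
      (fun b : P' => MulOpposite.op b • ExtendedBundle.mk hQ (u, a)) 1 :=
    ((hact.comp (contMDiff_const.prodMk contMDiff_id)).contMDiffAt).mdifferentiableAt (by simp)
  have h1 := mfderiv_comp_apply_of_eq (I := IP') (I' := IP') (I'' := IB')
    (h := fun b => ExtendedBundle.mk hQ (u, b)) (f := fun b => a⁻¹ * b) (x := a) hop
    (mdifferentiableAt_mul_left a⁻¹ a) (inv_mul_cancel a)
    (fun b => by rw [ExtendedBundle.op_smul_mk, mul_inv_cancel_left]) η
  refine Eq.trans ?_ (hθ'.cartan.fundamental (ExtendedBundle.mk hQ (u, a)) (maurerCartan IP' a η))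
  refine Eq.trans ?_ (congrArg (fun f : EB' →L[ℝ] E' => f _)
    (form_congr (F := E') θ' (one_smul (P')ᵐᵒᵖ (ExtendedBundle.mk hQ (u, a))).symm))
  exact congrArg (θ' (ExtendedBundle.mk hQ (u, a)) : EB' → E') h1

/-- The tangent space of the extended bundle at `[u, a]` is spanned by the vectors tangent to the
image of the original bundle and the vertical vectors, hence `𝔤' = Ad(a⁻¹) i'(𝔤) + 𝔭'`. -/
theorem IsInducedGeometry.exists_sub_mem
    (hθ' : IsInducedGeometry I I' IP' hQ IB IM' IB' θ θ') (u : B) (a : P')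
    (x : GroupLieAlgebra I' G') :
    ∃ y : GroupLieAlgebra I G,
      x - Ad I' (a : G')⁻¹ (lieMap I I' i y) ∈ subgroupLieAlgebra I' IP' P' := by
  obtain ⟨w, hw⟩ := (hθ'.cartan.isInvertible (ExtendedBundle.mk hQ (u, a))).surjective x
  obtain ⟨⟨ξ, η⟩, hv⟩ := hθ'.submersion_bundle.surjective_mfderiv (u, a) w
  refine ⟨θ u ξ, maurerCartan IP' a η, ?_⟩
  have h1 := (mfderiv_mk_apply hθ'.submersion_bundle u a ξ η).symm.trans hv
  have h2 := congrArg (θ' (ExtendedBundle.mk hQ (u, a)) : EB' →L[ℝ] E') h1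
  rw [map_add] at h2
  have h3 : Ad I' (a : G')⁻¹ (lieMap I I' i (θ u ξ)) +
      lieMap IP' I' P'.subtype (maurerCartan IP' a η) = x :=
    (congrArg₂ (fun x y : E' => x + y) (hθ'.pullback_mk a u ξ)
      (hθ'.apply_fibre a u η)).symm.trans (h2.trans hw)
  change lieMap IP' I' P'.subtype (maurerCartan IP' a η) = _
  rw [← h3, add_sub_cancel_left]

variable [LieGroup IP ∞ P]

/-- If `Ad(a⁻¹) i'(y)` lies in `𝔭'`, then `y` lies in `𝔭`: the vector `ξ` with `θ(ξ) = y` is mapped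
by `u ↦ [u, a]` to a vertical vector, hence it is vertical for the projection to the base. This is
the infinitesimal form of `i⁻¹(P') ⊆ P`, obtained without the exponential map. -/
theorem IsInducedGeometry.mem_of_map_mem {π : B → M}
    (hπ : IsPrincipalBundle IP (P := P) IB IM π) (hθ : IsCartanConnection I IP (P := P) IB θ)
    (hθ' : IsInducedGeometry I I' IP' hQ IB IM' IB' θ θ') (u : B) (a : P')
    (y : GroupLieAlgebra I G)
    (hy : Ad I' (a : G')⁻¹ (lieMap I I' i y) ∈ subgroupLieAlgebra I' IP' P') :
    y ∈ subgroupLieAlgebra I IP P := by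
  obtain ⟨A, hA⟩ := hy
  replace hA : lieMap IP' I' P'.subtype A = _ := hA
  obtain ⟨ξ, rfl⟩ := (hθ.isInvertible u).surjective y
  let η : EP' := mfderiv IP' IP' (fun b => a * b) 1 A
  have hη : maurerCartan IP' a η = A := by
    refine Eq.trans ?_ ((maurerCartan_mul_left a 1 A).trans (maurerCartan_one A))
    exact congrArg (fun f : EP' →L[ℝ] EP' => f η)
      (form_congr (F := EP') (maurerCartan IP') (mul_one a).symm)
  have h1 : (mfderiv IB IB' (fun v => ExtendedBundle.mk hQ (v, a)) u ξ : EB') =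
      mfderiv IP' IB' (fun b => ExtendedBundle.mk hQ (u, b)) a η := by
    apply (hθ'.cartan.isInvertible (ExtendedBundle.mk hQ (u, a))).injective
    refine (hθ'.pullback_mk a u ξ).trans ?_
    refine Eq.trans ?_ (hθ'.apply_fibre a u η).symm
    rw [hη, hA]
  have h2 : (mfderiv (IB.prod IP') IB' (ExtendedBundle.mk hQ (B := B)) (u, a)
      ((ξ, -η) : EB × EP') : EB') = 0 := by
    rw [mfderiv_mk_apply hθ'.submersion_bundle u a ξ (-η), h1]
    have : (mfderiv IP' IB' (fun b => ExtendedBundle.mk hQ (u, b)) a (-η) : EB') =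
        -(mfderiv IP' IB' (fun b => ExtendedBundle.mk hQ (u, b)) a η : EB') := map_neg _ _
    rw [this, add_neg_cancel]
  let Φ : ExtendedBundle hQ B → M := ExtendedBundle.toBase π hπ.proj_action
  have hcomp : ContMDiff (IB.prod IP') IM ∞ (Φ ∘ ExtendedBundle.mk hQ (B := B)) :=
    hπ.contMDiff_proj.comp contMDiff_fst
  have hΦ : MDifferentiableAt IB' IM Φ (ExtendedBundle.mk hQ (u, a)) :=
    (hθ'.submersion_bundle.contMDiffAt_of_comp hcomp.contMDiffAt).mdifferentiableAt (by simp)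
  have h3 := mfderiv_comp_apply_of_eq (I := IB.prod IP') (I' := IB') (I'' := IM)
    (h := fun x : B × P' => π x.1) hΦ (mdifferentiableAt_mk hθ'.submersion_bundle (u, a)) rfl
    (fun _ => rfl) ((ξ, -η) : EB × EP')
  have h4 := mfderiv_comp_apply_of_eq (I := IB.prod IP') (I' := IB) (I'' := IM)
    (h := fun x : B × P' => π x.1) (f := Prod.fst) (x := (u, a))
    (hπ.contMDiff_proj.contMDiffAt.mdifferentiableAt (x := u) (by simp)) mdifferentiableAt_fst rfl
    (fun _ => rfl) ((ξ, -η) : EB × EP')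
  have h5 : mfderiv IB IM π u ξ = 0 := by
    have e : (mfderiv (IB.prod IP') IB Prod.fst (u, a) ((ξ, -η) : EB × EP') : EB) = ξ := by
      rw [mfderiv_fst]; rfl
    rw [e] at h4
    refine h4.symm.trans (h3.trans ?_)
    rw [h2]
    exact map_zero (mfderiv IB' IM Φ (ExtendedBundle.mk hQ (u, a)))
  obtain ⟨A₀, hA₀⟩ := hπ.exists_generator u ξ h5
  refine ⟨A₀, ?_⟩
  refine (hθ.fundamental u A₀).symm.trans ?_
  refine (congrArg (fun f : EB →L[ℝ] E => f _)
    (form_congr (F := E) θ (one_smul (P)ᵐᵒᵖ u))).trans ?_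
  exact congrArg (θ u : EB → E) hA₀

end Fefferman

/-! ### Lie algebras of parabolic subgroups -/

section Subgroup

variable {E H : Type*} [NormedAddCommGroup E] [NormedSpace ℝ E] [TopologicalSpace H]
  {I : ModelWithCorners ℝ E H} {G : Type*} [TopologicalSpace G] [ChartedSpace H G] [Group G]
  {EP HP : Type*} [NormedAddCommGroup EP] [NormedSpace ℝ EP] [TopologicalSpace HP]
  {IP : ModelWithCorners ℝ EP HP} {P : Subgroup G} [ChartedSpace HP P]
  [LieGroup I ∞ G] [LieGroup IP ∞ P]

theorem Ad_mem_subgroupLieAlgebra (hP : ContMDiff IP I ∞ (Subtype.val : P → G)) (p : P)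
    {x : GroupLieAlgebra I G} (hx : x ∈ subgroupLieAlgebra I IP P) :
    Ad I (p : G) x ∈ subgroupLieAlgebra I IP P := by
  obtain ⟨A, rfl⟩ := hx
  refine ⟨Ad IP p A, ?_⟩
  have hval (q : P) : MDifferentiableAt IP I (Subtype.val : P → G) q :=
    hP.contMDiffAt.mdifferentiableAt (by simp)
  have h1 := mfderiv_comp_apply_of_eq (I := IP) (I' := IP) (I'' := I) (x := (1 : P))
    (h := fun q : P => (p : G) * q * (p : G)⁻¹) (hval 1) (mdifferentiableAt_conj p 1)
    (by group) (fun q => rfl) A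
  have h2 := mfderiv_comp_apply_of_eq (I := IP) (I' := I) (I'' := I) (x := (1 : P))
    (h := fun q : P => (p : G) * q * (p : G)⁻¹) (mdifferentiableAt_conj (p : G) (1 : G))
    (hval 1) rfl (fun q => rfl) A
  exact h1.symm.trans h2

variable [FiniteDimensional ℝ E] [I.Boundaryless] [FiniteDimensional ℝ EP] [IP.Boundaryless]
  [CompleteSpace E] [CompleteSpace EP]

theorem lie_mem_subgroupLieAlgebra (hP : ContMDiff IP I ∞ (Subtype.val : P → G))
    {x y : GroupLieAlgebra I G} (hx : x ∈ subgroupLieAlgebra I IP P)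
    (hy : y ∈ subgroupLieAlgebra I IP P) : ⁅x, y⁆ ∈ subgroupLieAlgebra I IP P := by
  obtain ⟨A, rfl⟩ := hx
  obtain ⟨A', rfl⟩ := hy
  exact ⟨⁅A, A'⁆, lieMap_lie (f := P.subtype) hP A A'⟩

theorem IsParabolicSubgroup.killingForm_nondegenerate
    (hG : LieAlgebra.IsSimple ℝ (GroupLieAlgebra I G)) (hP : IsParabolicSubgroup I IP P)
    (x : GroupLieAlgebra I G) (hx : ∀ y, killingForm ℝ (GroupLieAlgebra I G) x y = 0) : x = 0 :=
  killingForm_nondegenerate_of_parabolic hG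
    (f := { (lieMap IP I P.subtype).toLinearMap with
      map_lie' := lieMap_lie (f := P.subtype) hP.contMDiff_subtype _ _ })
    (hP.injective_mfderiv 1) hP.nilradical_eq hx

end Subgroup

/-! ### The curvature function -/

section Curvature

variable {E H : Type*} [NormedAddCommGroup E] [NormedSpace ℝ E] [TopologicalSpace H]
  {I : ModelWithCorners ℝ E H} {G : Type*} [TopologicalSpace G] [ChartedSpace H G] [Group G]
  {EP HP : Type*} [NormedAddCommGroup EP] [NormedSpace ℝ EP] [TopologicalSpace HP]
  {IP : ModelWithCorners ℝ EP HP} {P : Subgroup G} [ChartedSpace HP P]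
  {EB HB : Type*} [NormedAddCommGroup EB] [NormedSpace ℝ EB] [TopologicalSpace HB]
  {IB : ModelWithCorners ℝ EB HB} {B : Type*} [TopologicalSpace B] [ChartedSpace HB B]
  [IsManifold IB ∞ B]

theorem IsCartanConnection.apply_inverse [MulAction (P)ᵐᵒᵖ B]
    {θ : ∀ u : B, TangentSpace IB u →L[ℝ] GroupLieAlgebra I G}
    (hθ : IsCartanConnection I IP (P := P) IB θ) (u : B) (X : GroupLieAlgebra I G) :
    θ u ((θ u).inverse X) = X :=
  (hθ.isInvertible u).self_apply_inverse X

variable [FiniteDimensional ℝ EB] [IB.Boundaryless]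

/-- Naturality of the curvature function: if the pullback of a Cartan connection along a smooth map
`f` is the composition of a Cartan connection with a homomorphism `T` of Lie algebras, then `T`
relates the curvature functions. -/
theorem curvatureFunction_of_pullback {E' H' : Type*} [NormedAddCommGroup E'] [NormedSpace ℝ E']
    [TopologicalSpace H'] {I' : ModelWithCorners ℝ E' H'} {G' : Type*} [TopologicalSpace G']
    [ChartedSpace H' G'] [Group G'] [CompleteSpace E'] [LieGroup I' ∞ G']
    {EB' HB' : Type*} [NormedAddCommGroup EB'] [NormedSpace ℝ EB'] [TopologicalSpace HB']
    {IB' : ModelWithCorners ℝ EB' HB'} {B' : Type*} [TopologicalSpace B'] [ChartedSpace HB' B']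
    [FiniteDimensional ℝ EB'] [IB'.Boundaryless] [IsManifold IB' ∞ B']
    {θ : ∀ u : B, TangentSpace IB u →L[ℝ] GroupLieAlgebra I G}
    {θ' : ∀ u : B', TangentSpace IB' u →L[ℝ] GroupLieAlgebra I' G'}
    (hθ : IsSmoothForm (F := E) IB θ) (hinv : ∀ u, (θ u).IsInvertible)
    (hθ' : IsSmoothForm (F := E') IB' θ') (hinv' : ∀ u, (θ' u).IsInvertible)
    {f : B → B'} (hf : ContMDiff IB IB' ∞ f)
    (T : GroupLieAlgebra I G →L[ℝ] GroupLieAlgebra I' G') (hT : ∀ X Y, T ⁅X, Y⁆ = ⁅T X, T Y⁆)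
    (hpull : ∀ u ξ, θ' (f u) (mfderiv IB IB' f u ξ) = T (θ u ξ)) (u : B)
    (X Y : GroupLieAlgebra I G) :
    curvatureFunction I' IB' θ' (f u) (T X) (T Y) = T (curvatureFunction I IB θ u X Y) := by
  have hinverse (X : GroupLieAlgebra I G) :
      (θ' (f u)).inverse (T X) = mfderiv IB IB' f u ((θ u).inverse X) := by
    apply (hinv' (f u)).injective
    rw [(hinv' (f u)).self_apply_inverse, hpull, (hinv u).self_apply_inverse]
  have hd : lieExtDeriv I' IB' θ' (f u) (mfderiv IB IB' f u ((θ u).inverse X))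
      (mfderiv IB IB' f u ((θ u).inverse Y)) =
      T (lieExtDeriv I IB θ u ((θ u).inverse X) ((θ u).inverse Y)) :=
    mextDeriv_of_pullback (F := E) (F' := E') hθ hθ' hf T hpull u _ _
  rw [curvatureFunction, curvatureFunction, curvature, curvature, map_add, hT, hinverse, hinverse,
    hd, hpull, hpull]

variable [CompleteSpace E] [LieGroup I ∞ G]

theorem curvatureFunction_swap {θ : ∀ u : B, TangentSpace IB u →L[ℝ] GroupLieAlgebra I G}
    (hθ : IsSmoothForm (F := E) IB θ) (u : B) (X Y : GroupLieAlgebra I G) :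
    curvatureFunction I IB θ u X Y = -curvatureFunction I IB θ u Y X :=
  curvature_swap hθ u _ _

theorem curvatureFunction_eq_zero_of_mem [MulAction (P)ᵐᵒᵖ B] [FiniteDimensional ℝ E]
    [I.Boundaryless] [IP.Boundaryless] [LieGroup IP ∞ P]
    {θ : ∀ u : B, TangentSpace IB u →L[ℝ] GroupLieAlgebra I G}
    (hθ : IsCartanConnection I IP (P := P) IB θ)
    (hact : ContMDiff (IB.prod IP) IB ∞ (fun x : B × P => MulOpposite.op x.2 • x.1))
    (hsub : ContMDiff IP I ∞ (Subtype.val : P → G)) (u : B) {X : GroupLieAlgebra I G}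
    (hX : X ∈ subgroupLieAlgebra I IP P) (Y : GroupLieAlgebra I G) :
    curvatureFunction I IB θ u X Y = 0 :=
  curvature_eq_zero_of_mem hθ hact hsub u _ _ ((hθ.apply_inverse u X).symm ▸ hX)

end Curvature

end Parabolic

/-! ### Normality of the induced geometry -/

theorem mainTheorem7
    {dG dP dG' dP' dM dB dM' dB' : ℕ}
    {G : Type*} [TopologicalSpace G] [ChartedSpace (EuclideanSpace ℝ (Fin dG)) G] [Group G]
    [LieGroup (𝓡 dG) ∞ G]
    (P : Subgroup G) [ChartedSpace (EuclideanSpace ℝ (Fin dP)) P] [LieGroup (𝓡 dP) ∞ P]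
    {G' : Type*} [TopologicalSpace G'] [ChartedSpace (EuclideanSpace ℝ (Fin dG')) G'] [Group G']
    [LieGroup (𝓡 dG') ∞ G']
    (P' : Subgroup G') [ChartedSpace (EuclideanSpace ℝ (Fin dP')) P'] [LieGroup (𝓡 dP') ∞ P']
    (hG : LieAlgebra.IsSimple ℝ (GroupLieAlgebra (𝓡 dG) G))
    (hG' : LieAlgebra.IsSimple ℝ (GroupLieAlgebra (𝓡 dG') G'))
    (i : G →* G')
    (hi : Parabolic.IsFeffermanData (𝓡 dG) (𝓡 dP) P (𝓡 dG') (𝓡 dP') P' i)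
    (hQ : P'.comap i ≤ P)
    (hgrad : Parabolic.IsOneGraded (Parabolic.subgroupLieAlgebra (𝓡 dG') (𝓡 dP') P'))
    {M : Type*} [TopologicalSpace M] [ChartedSpace (EuclideanSpace ℝ (Fin dM)) M]
    [IsManifold (𝓡 dM) ∞ M]
    {B : Type*} [TopologicalSpace B] [ChartedSpace (EuclideanSpace ℝ (Fin dB)) B]
    [IsManifold (𝓡 dB) ∞ B] [MulAction (P)ᵐᵒᵖ B]
    (π : B → M) (hπ : Parabolic.IsPrincipalBundle (𝓡 dP) (P := P) (𝓡 dB) (𝓡 dM) π)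
    (θ : ∀ u : B, TangentSpace (𝓡 dB) u →L[ℝ] GroupLieAlgebra (𝓡 dG) G)
    (hθ : Parabolic.IsCartanConnection (𝓡 dG) (𝓡 dP) (P := P) (𝓡 dB) θ)
    [ChartedSpace (EuclideanSpace ℝ (Fin dM')) (Parabolic.FeffermanSpace hQ B)]
    [IsManifold (𝓡 dM') ∞ (Parabolic.FeffermanSpace hQ B)]
    [ChartedSpace (EuclideanSpace ℝ (Fin dB')) (Parabolic.ExtendedBundle hQ B)]
    [IsManifold (𝓡 dB') ∞ (Parabolic.ExtendedBundle hQ B)]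
    (θ' : ∀ u : Parabolic.ExtendedBundle hQ B,
      TangentSpace (𝓡 dB') u →L[ℝ] GroupLieAlgebra (𝓡 dG') G')
    (hθ' : Parabolic.IsInducedGeometry (𝓡 dG) (𝓡 dG') (𝓡 dP') hQ (𝓡 dB) (𝓡 dM') (𝓡 dB') θ θ')
    (hvalues : ∀ (u : B) (X Y : GroupLieAlgebra (𝓡 dG) G),
      Parabolic.lieMap (𝓡 dG) (𝓡 dG') i (Parabolic.curvatureFunction (𝓡 dG) (𝓡 dB) θ u X Y) ∈
        Parabolic.subgroupLieAlgebra (𝓡 dG') (𝓡 dP') P')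
    (hone : Parabolic.CodiffOneVanishes (𝓡 dG) (𝓡 dP) P (𝓡 dB) θ)
    (htwo : Parabolic.CodiffTwoVanishes (𝓡 dG) (𝓡 dP) P (𝓡 dB) θ) :
    Parabolic.IsNormal (𝓡 dG') (𝓡 dP') P' (𝓡 dB') θ' := by
  intro n X Z hXZ ũ A
  have : FiniteDimensional ℝ (GroupLieAlgebra (𝓡 dG) G) :=
    inferInstanceAs (FiniteDimensional ℝ (EuclideanSpace ℝ (Fin dG)))
  have : FiniteDimensional ℝ (GroupLieAlgebra (𝓡 dG') G') :=
    inferInstanceAs (FiniteDimensional ℝ (EuclideanSpace ℝ (Fin dG')))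
  obtain ⟨u, a, rfl⟩ := Parabolic.ExtendedBundle.exists_rep ũ
  have hP := hi.parabolic.contMDiff_subtype
  have hP' := hi.parabolic'.contMDiff_subtype
  have hact' := Parabolic.contMDiff_extendedBundle_action hθ'.submersion_bundle
  -- the linear map `φ` relating the two curvature functions
  let T : GroupLieAlgebra (𝓡 dG) G →L[ℝ] GroupLieAlgebra (𝓡 dG') G' :=
    (Parabolic.Ad (𝓡 dG') (a : G')⁻¹).comp (Parabolic.lieMap (𝓡 dG) (𝓡 dG') i)
  have hT (X Y) : T ⁅X, Y⁆ = ⁅T X, T Y⁆ := by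
    change Parabolic.Ad (𝓡 dG') (a : G')⁻¹ (Parabolic.lieMap (𝓡 dG) (𝓡 dG') i ⁅X, Y⁆) = _
    rw [Parabolic.lieMap_lie hi.contMDiff, Parabolic.Ad_lie]
    rfl
  have hja : ContMDiff (𝓡 dB) (𝓡 dB') ∞
      (fun v : B => Parabolic.ExtendedBundle.mk hQ (v, a)) :=
    hθ'.submersion_bundle.contMDiff.comp (contMDiff_id.prodMk contMDiff_const)
  obtain ⟨κ, hκ⟩ := Parabolic.exists_curvatureFunction_linear hθ.smooth u
  obtain ⟨κ', hκ'⟩ := Parabolic.exists_curvatureFunction_linear hθ'.cartan.smooth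
    (Parabolic.ExtendedBundle.mk hQ (u, a))
  have hhor' : ∀ x ∈ Parabolic.subgroupLieAlgebra (𝓡 dG') (𝓡 dP') P', ∀ y, κ' x y = 0 :=
    fun x hx y => (hκ' x y).trans
      (Parabolic.curvatureFunction_eq_zero_of_mem hθ'.cartan hact' hP' _ hx y)
  -- parabolicity turns `𝔭'₊` into `𝔭'^⊥`
  rw [hi.parabolic'.nilradical_eq] at hXZ
  have key := Parabolic.codiff_eq_zero_of_related
    (fun x hx => hi.parabolic.killingForm_nondegenerate hG x hx)
    (fun x hx => hi.parabolic'.killingForm_nondegenerate hG' x hx) hgrad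
    (fun x hx y hy => Parabolic.lie_mem_subgroupLieAlgebra hP' hx hy)
    (T).toLinearMap hT (hθ'.exists_sub_mem u a)
    (fun y hy => hθ'.mem_of_map_mem hπ hθ u a y hy) κ κ'
    (fun x hx y => (hκ x y).trans
      (Parabolic.curvatureFunction_eq_zero_of_mem hθ hπ.contMDiff_action hP u hx y))
    hhor'
    (fun y hy x => by
      rw [hκ', Parabolic.curvatureFunction_swap hθ'.cartan.smooth, ← hκ', hhor' y hy, neg_zero])
    (fun x y => by
      rw [hκ, hκ']
      exact Parabolic.curvatureFunction_of_pullback hθ.smooth hθ.isInvertible hθ'.cartan.smooth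
        hθ'.cartan.isInvertible hja (T) hT (fun v ξ => hθ'.pullback_mk a v ξ) u x y)
    (fun x y => by
      rw [hκ]
      exact Parabolic.Ad_mem_subgroupLieAlgebra hP' a⁻¹ (hvalues u x y))
    (fun m Y W hYW b => by
      simp only [hκ]
      exact hone m Y W (hi.parabolic.nilradical_eq ▸ hYW) u b)
    hXZ A
  simpa only [hκ'] using key
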